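/- **Theorem.** In intuitionistic first-order logic with equality, Euclidean field theory EF does not prove Markov's principle $\forall x\,(\neg\neg P(x)\to P(x))$, and the geometrical theory EG does not prove Markov's principle $\forall a\,b\,c\,(\neg\neg \mathbf B(a,b,c)\to\mathbf B(a,b,c))$. More precisely, non-Archimedean Euclidean ordered fields (ordered fields in which every non-negative element is a square) exist, and for each such field $\mathbb F$ the following holds. Let $\mathbb F_0=\{x\in\mathbb F: |x|\le n \text{ for some } n\in\mathbb N\}$, and call $x$ infinitesimal if $x=0$ or $1/x\notin\mathbb F_0$. (1) The two-node Kripke model with root $\mathbb F_0$, where $P(x)$ is read as "$x$ is positive in $\mathbb F$ and not infinitesimal", and with top node $\mathbb F$, where $P(x)$ is read as $x>0$, satisfies EF at both nodes, and its root does not satisfy Markov's principle. (2) The two-node Kripke model with root $\mathbb F_0^2$ and top node $\mathbb F^2$ satisfies EG at both nodes, and its root does not satisfy Markov's principle. Here at each node $\mathbf B(a,b,c)$ means $(c-b)\times(b-a)=0$ and $P((b-c)\cdot(a-b))$, and $E(a,b,c,d)$ (written $ab=cd$) means $(b-a)^2=(d-c)^2$. **EF.** The language has $0,1,-,+,\cdot$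 and the predicate $P$. The axioms are the commutative ring laws, $\neg x\ne y\to x=y$, and EF0: $0\neq1$; EF1: $P(x)\to\exists y\,(xy=1\wedge P(y))$; EF2: $P(x)\wedge P(y)\to P(x+y)\wedge P(xy)$; EF3: $x+y=0\to\neg(P(x)\wedge P(y))$; EF4: $x+y=0\wedge\neg P(x)\wedge\neg P(y)\to x=0$; EF5: $x+y=0\wedge\neg P(y)\to\exists z\,(zz=x)$. **EG.** The language has a ternary predicate $\mathbf B$ (strict betweenness) and a quaternary predicate $E$. Abbreviations: - $a\#b:=\exists c\,(\mathbf B(c,a,b)\vee\mathbf B(a,c,b)\vee\mathbf B(a,b,c))$; - $R(a,b,c):=\exists d\,(\mathbf B(a,b,d)\wedge ab=bd\wedge ac=dc\wedge a\#b\wedge c\#b\wedge a\#c)$; - $Ray(a,b,x):=\exists d\,(\mathbf B(d,a,b)\wedge\mathbf B(d,a,x))$; - $apex(a,b,c):=\exists u,v\,(Ray(b,a,u)\wedge Ray(b,c,v)\wedge bu=bv\wedge u\#v)$; - $\angle abc=\angle ABC:=\exists u,v,U,V\,(Ray(b,a,u)\wedge Ray(b,c,v)\wedge Ray(B,A,U)\wedge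 Ray(B,C,V)\wedge bu=BU\wedge bv=BV\wedge uv=UV)$; - $0<abc:=apex(a,b,c)\vee R(a,b,c)\vee\exists A,B,C\,(\angle abc=\angle ABC\wedge(R(B,A,C)\vee R(A,C,B)))$; - $abc<\pi:=\exists d\,(\mathbf B(d,b,a)\wedge 0<dbc)$; and $0<abc<\pi$ is the conjunction of $0<abc$ and $abc<\pi$; - $\mathbf T(a,b,c):=\neg(a\ne b\wedge\neg\mathbf B(a,b,c)\wedge b\neq c)$; - $L(a,b,c):=\neg\neg(\mathbf B(c,a,b)\vee c=a\vee\mathbf B(a,c,b)\vee c=b\vee\mathbf B(a,b,c))$. The axioms are the universal closures of: - $ab=ba$; $\;ab=pq\wedge ab=rs\to pq=rs$; $\;ab=cc\to a=b$; $\;\neg\neg\,ab=cd\to ab=cd$; - $\neg\mathbf B(a,b,a)$; $\;\mathbf B(a,b,c)\to\mathbf B(c,b,a)$; $\;\mathbf B(a,b,d)\wedge\mathbf B(b,c,d)\to\mathbf B(a,b,c)$; $\;\mathbf B(a,b,d)\wedge\mathbf B(a,c,d)\wedge\neg\mathbf B(a,b,c)\wedge\neg\mathbf B(a,c,b)\to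 b=c$; - (extension) $A\#B\wedge ab=AB\to\exists e\,(\mathbf T(a,b,e)\wedge be=cd)$; - (strict extension) $A\#B\wedge ab=AB\wedge C\#D\wedge cd=CD\to\exists e\,(\mathbf B(a,b,e)\wedge be=cd)$; - (five segments) $a\#b\wedge\mathbf T(a,b,c)\wedge\mathbf T(A,B,C)\wedge ab=AB\wedge bc=BC\wedge ad=AD\wedge bd=BD\to cd=CD$; - (inner Pasch) $\mathbf B(a,p,c)\wedge\mathbf B(b,q,c)\wedge(0<acb<\pi\vee0<qpa<\pi)\to\exists x\,(\mathbf B(p,x,b)\wedge\mathbf B(a,x,q))$; - (outer Pasch) $\mathbf B(a,p,c)\wedge\mathbf B(b,c,q)\wedge(0<baq<\pi\vee0<abq<\pi)\to\exists x\,(\mathbf B(b,p,x)\wedge\mathbf B(a,x,q))$; - (lower dimension) there are $\alpha,\beta,\gamma,c_1,c_2,c_3,c_4$ with $\alpha\beta=\beta\gamma$, $\alpha\beta=\alpha\gamma$, $\alpha\ne\beta$, $\mathbf B(\alpha,c_1,\beta)$, $\alpha c_1=c_1\beta$, $\mathbf B(\alpha,c_2,\gamma)$, $\alpha c_2=c_2\gamma$,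 $\mathbf B(\beta,c_3,\gamma)$, $\beta c_3=c_3\gamma$, $\mathbf B(\beta,c_4,c_2)$, $\mathbf B(\gamma,c_4,c_1)$; - (line-circle) $a\#b\wedge\mathbf B(u,a,v)\wedge cu=pq\wedge cv=pq\wedge\mathbf B(u,c,v)\to\exists x,y\,(cx=pq\wedge cy=pq\wedge\mathbf B(x,a,y)\wedge L(a,b,x)\wedge L(a,b,y))$, and the same formula with $\mathbf T$ in place of $\mathbf B$ in the three places shown; - (circle-circle) $ca=pq\wedge\mathbf T(u,a,v)\wedge\mathbf T(u,C,v)\wedge Cu=PQ\wedge Cv=PQ\wedge cb=pq\wedge\mathbf B(C,w,b)\wedge Cw=PQ\to\exists e\,(ce=pq\wedge Ce=PQ)$, and the same formula with $\mathbf T(C,w,b)$ in place of $\mathbf B(C,w,b)$ and the additional hypothesis $c\#C$; - (Euclid 5) $p\#a\wedge s\#q\wedge pt=qt\wedge\mathbf B(p,t,q)\wedge st=rt\wedge\mathbf B(s,t,r)\wedge pr=qs\wedge\mathbf B(q,a,r)\to\exists e\,(\mathbf B(p,a,e)\wedge\mathbf B(s,q,e))$. -/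

import Mathlib

universe u

/-! ### Intuitionistic first-order logic with equality -/

/-- First-order formulas over a language `L`, with all connectives primitive. Variables are de Bruijn
indices: inside a quantifier, `0` is the bound variable and the outer variable `n` becomes `n + 1`. -/
inductive Fml (L : FirstOrder.Language.{0, 0}) : Type where
  | falsum : Fml L
  | eq (t s : L.Term ℕ) : Fml L
  | rel {n : ℕ} (R : L.Relations n) (ts : Fin n → L.Term ℕ) : Fml L
  | and (φ ψ : Fml L) : Fml L
  | or (φ ψ : Fml L) : Fml L
  | imp (φ ψ : Fml L) : Fml L
  | all (φ : Fml L) : Fml L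
  | ex (φ : Fml L) : Fml L

infix:70 " ≐ " => Fml.eq
infixr:65 " ∧ᵢ " => Fml.and
infixr:62 " ∨ᵢ " => Fml.or
infixr:60 " ⇒ᵢ " => Fml.imp

namespace Fml

variable {L : FirstOrder.Language.{0, 0}}

/-- Intuitionistic negation, `φ → ⊥`. -/
def neg (φ : Fml L) : Fml L := φ ⇒ᵢ falsum

/-- `alls n φ` is `∀ … ∀ φ` with `n` quantifiers; it binds the variables `0, …, n - 1` of `φ`. -/
def alls : ℕ → Fml L → Fml L
  | 0, φ => φ
  | n + 1, φ => alls n (all φ)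

/-- `exs n φ` is `∃ … ∃ φ` with `n` quantifiers; it binds the variables `0, …, n - 1` of `φ`. -/
def exs : ℕ → Fml L → Fml L
  | 0, φ => φ
  | n + 1, φ => exs n (ex φ)

/-- The substitution `σ` carried under one quantifier. -/
def liftSubst (σ : ℕ → L.Term ℕ) : ℕ → L.Term ℕ
  | 0 => .var 0
  | n + 1 => (σ n).relabel Nat.succ

/-- Simultaneous capture-avoiding substitution. -/
def subst : (ℕ → L.Term ℕ) → Fml L → Fml L
  | _, falsum => falsum
  | σ, eq t s => eq (t.subst σ) (s.subst σ)
  | σ, rel R ts => rel R fun i => (ts i).subst σ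
  | σ, and φ ψ => and (φ.subst σ) (ψ.subst σ)
  | σ, or φ ψ => or (φ.subst σ) (ψ.subst σ)
  | σ, imp φ ψ => imp (φ.subst σ) (ψ.subst σ)
  | σ, all φ => all (φ.subst (liftSubst σ))
  | σ, ex φ => ex (φ.subst (liftSubst σ))

/-- Weakening by a fresh variable `0`. -/
def shift (φ : Fml L) : Fml L := φ.subst fun n => .var (n + 1)

/-- Instantiation of the variable `0` by the term `t`. -/
def inst (φ : Fml L) (t : L.Term ℕ) : Fml L :=
  φ.subst fun n => Nat.casesOn n t fun m => .var m

end Fml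

prefix:68 "¬ᵢ" => Fml.neg

/-- Natural deduction for intuitionistic first-order logic with equality. -/
inductive Provable {L : FirstOrder.Language.{0, 0}} : Set (Fml L) → Fml L → Prop where
  | hyp {Γ : Set (Fml L)} {φ : Fml L} : φ ∈ Γ → Provable Γ φ
  | falsumE {Γ : Set (Fml L)} {φ : Fml L} : Provable Γ .falsum → Provable Γ φ
  | andI {Γ : Set (Fml L)} {φ ψ : Fml L} : Provable Γ φ → Provable Γ ψ → Provable Γ (φ ∧ᵢ ψ)
  | andE₁ {Γ : Set (Fml L)} {φ ψ : Fml L} : Provable Γ (φ ∧ᵢ ψ) → Provable Γ φ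
  | andE₂ {Γ : Set (Fml L)} {φ ψ : Fml L} : Provable Γ (φ ∧ᵢ ψ) → Provable Γ ψ
  | orI₁ {Γ : Set (Fml L)} {φ ψ : Fml L} : Provable Γ φ → Provable Γ (φ ∨ᵢ ψ)
  | orI₂ {Γ : Set (Fml L)} {φ ψ : Fml L} : Provable Γ ψ → Provable Γ (φ ∨ᵢ ψ)
  | orE {Γ : Set (Fml L)} {φ ψ χ : Fml L} : Provable Γ (φ ∨ᵢ ψ) →
      Provable (insert φ Γ) χ → Provable (insert ψ Γ) χ → Provable Γ χ
  | impI {Γ : Set (Fml L)} {φ ψ : Fml L} : Provable (insert φ Γ) ψ → Provable Γ (φ ⇒ᵢ ψ)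
  | impE {Γ : Set (Fml L)} {φ ψ : Fml L} : Provable Γ (φ ⇒ᵢ ψ) → Provable Γ φ → Provable Γ ψ
  | allI {Γ : Set (Fml L)} {φ : Fml L} : Provable (Fml.shift '' Γ) φ → Provable Γ (.all φ)
  | allE {Γ : Set (Fml L)} {φ : Fml L} (t : L.Term ℕ) : Provable Γ (.all φ) → Provable Γ (φ.inst t)
  | exI {Γ : Set (Fml L)} {φ : Fml L} (t : L.Term ℕ) : Provable Γ (φ.inst t) → Provable Γ (.ex φ)
  | exE {Γ : Set (Fml L)} {φ ψ : Fml L} : Provable Γ (.ex φ) →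
      Provable (insert φ (Fml.shift '' Γ)) ψ.shift → Provable Γ ψ
  | eqRefl {Γ : Set (Fml L)} (t : L.Term ℕ) : Provable Γ (t ≐ t)
  | eqSubst {Γ : Set (Fml L)} {φ : Fml L} {t s : L.Term ℕ} : Provable Γ (t ≐ s) →
      Provable Γ (φ.inst t) → Provable Γ (φ.inst s)

/-! ### Kripke models -/

/-- A Kripke model over the preorder `W`: a nonempty `L`-structure at every node, and transition maps
that commute with the function symbols and preserve the relation symbols. -/
structure KripkeModel (L : FirstOrder.Language.{0, 0}) (W : Type) [Preorder W] : Type (u + 1) where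
  carrier : W → Type u
  [str : ∀ w, L.Structure (carrier w)]
  nonempty : ∀ w, Nonempty (carrier w)
  map : ∀ {w v : W}, w ≤ v → (FirstOrder.Language.Hom L (carrier w) (carrier v))
  map_refl : ∀ (w : W) (x : carrier w), map (le_refl w) x = x
  map_trans : ∀ {w v z : W} (h : w ≤ v) (h' : v ≤ z) (x : carrier w),
    map (h.trans h') x = map h' (map h x)

namespace KripkeModel

variable {L : FirstOrder.Language.{0, 0}} {W : Type} [Preorder W]

attribute [instance] KripkeModel.str

/-- The environment that sends the variable `0` to `x` and `n + 1` to `ρ n`. -/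
def extend {D : Type u} (x : D) (ρ : ℕ → D) : ℕ → D
  | 0 => x
  | n + 1 => ρ n

/-- The forcing relation. -/
def Forces (M : KripkeModel.{u} L W) : Fml L → (w : W) → (ℕ → M.carrier w) → Prop
  | .falsum, _, _ => False
  | .eq t s, _, ρ => t.realize ρ = s.realize ρ
  | .rel R ts, _, ρ => FirstOrder.Language.Structure.RelMap R fun i => (ts i).realize ρ
  | .and φ ψ, w, ρ => M.Forces φ w ρ ∧ M.Forces ψ w ρ
  | .or φ ψ, w, ρ => M.Forces φ w ρ ∨ M.Forces ψ w ρ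
  | .imp φ ψ, w, ρ => ∀ (v : W) (h : w ≤ v),
      M.Forces φ v (fun n => M.map h (ρ n)) → M.Forces ψ v (fun n => M.map h (ρ n))
  | .all φ, w, ρ => ∀ (v : W) (h : w ≤ v) (x : M.carrier v),
      M.Forces φ v (extend x fun n => M.map h (ρ n))
  | .ex φ, w, ρ => ∃ x : M.carrier w, M.Forces φ w (extend x ρ)

/-- The node `w` satisfies `φ` (under every assignment of the free variables). -/
def Satisfies (M : KripkeModel.{u} L W) (w : W) (φ : Fml L) : Prop :=
  ∀ ρ : ℕ → M.carrier w, M.Forces φ w ρ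

/-- `M` is a model of the theory `T`: every node satisfies every formula of `T`. -/
def IsModelOf (M : KripkeModel.{u} L W) (T : Set (Fml L)) : Prop :=
  ∀ φ ∈ T, ∀ w, M.Satisfies w φ

end KripkeModel

/-! ### Euclidean field theory -/

/-- Function symbols of Euclidean field theory. -/
inductive EFFunc : ℕ → Type where
  | zero : EFFunc 0
  | one : EFFunc 0
  | neg : EFFunc 1
  | add : EFFunc 2
  | mul : EFFunc 2

/-- The only relation symbol of Euclidean field theory, for positivity. -/
inductive EFRel : ℕ → Type where
  | pos : EFRel 1

/-- The language of Euclidean field theory. -/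
def EFLang : FirstOrder.Language.{0, 0} := ⟨EFFunc, EFRel⟩

namespace EF

/-- The variable `n` as a term. -/
def v (n : ℕ) : EFLang.Term ℕ := .var n
/-- The term `0`. -/
def zero : EFLang.Term ℕ := .func (l := 0) EFFunc.zero ![]
/-- The term `1`. -/
def one : EFLang.Term ℕ := .func (l := 0) EFFunc.one ![]
/-- The term `- t`. -/
def neg (t : EFLang.Term ℕ) : EFLang.Term ℕ := .func (l := 1) EFFunc.neg ![t]
/-- The term `t + s`. -/
def add (t s : EFLang.Term ℕ) : EFLang.Term ℕ := .func (l := 2) EFFunc.add ![t, s]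
/-- The term `t * s`. -/
def mul (t s : EFLang.Term ℕ) : EFLang.Term ℕ := .func (l := 2) EFFunc.mul ![t, s]
/-- The formula `P(t)`, i.e. `t` is positive. -/
def P (t : EFLang.Term ℕ) : Fml EFLang := .rel (n := 1) EFRel.pos ![t]

/-- The commutative ring laws. -/
def ringLaws : Set (Fml EFLang) :=
  { .alls 3 (add (add (v 0) (v 1)) (v 2) ≐ add (v 0) (add (v 1) (v 2))),
    .alls 2 (add (v 0) (v 1) ≐ add (v 1) (v 0)),
    .alls 1 (add (v 0) zero ≐ v 0),
    .alls 1 (add (v 0) (neg (v 0)) ≐ zero),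
    .alls 3 (mul (mul (v 0) (v 1)) (v 2) ≐ mul (v 0) (mul (v 1) (v 2))),
    .alls 2 (mul (v 0) (v 1) ≐ mul (v 1) (v 0)),
    .alls 1 (mul (v 0) one ≐ v 0),
    .alls 3 (mul (v 0) (add (v 1) (v 2)) ≐ add (mul (v 0) (v 1)) (mul (v 0) (v 2))) }

/-- `¬ x ≠ y → x = y` -/
def eqStable : Fml EFLang := .alls 2 (¬ᵢ ¬ᵢ (v 0 ≐ v 1) ⇒ᵢ v 0 ≐ v 1)
/-- `0 ≠ 1` -/
def EF0 : Fml EFLang := ¬ᵢ (zero ≐ one)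
/-- `P(x) → ∃ y, x y = 1 ∧ P(y)` -/
def EF1 : Fml EFLang := .alls 1 (P (v 0) ⇒ᵢ .ex (mul (v 1) (v 0) ≐ one ∧ᵢ P (v 0)))
/-- `P(x) ∧ P(y) → P(x + y) ∧ P(x y)` -/
def EF2 : Fml EFLang :=
  .alls 2 (P (v 0) ∧ᵢ P (v 1) ⇒ᵢ P (add (v 0) (v 1)) ∧ᵢ P (mul (v 0) (v 1)))
/-- `x + y = 0 → ¬ (P(x) ∧ P(y))` -/
def EF3 : Fml EFLang := .alls 2 (add (v 0) (v 1) ≐ zero ⇒ᵢ ¬ᵢ (P (v 0) ∧ᵢ P (v 1)))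
/-- `x + y = 0 ∧ ¬ P(x) ∧ ¬ P(y) → x = 0` -/
def EF4 : Fml EFLang :=
  .alls 2 (add (v 0) (v 1) ≐ zero ∧ᵢ ¬ᵢ P (v 0) ∧ᵢ ¬ᵢ P (v 1) ⇒ᵢ v 0 ≐ zero)
/-- `x + y = 0 ∧ ¬ P(y) → ∃ z, z z = x` -/
def EF5 : Fml EFLang :=
  .alls 2 (add (v 0) (v 1) ≐ zero ∧ᵢ ¬ᵢ P (v 1) ⇒ᵢ .ex (mul (v 0) (v 0) ≐ v 1))

/-- Euclidean field theory without Markov's principle (the theory of weakly Euclidean fields). -/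
def theory : Set (Fml EFLang) := ringLaws ∪ {eqStable, EF0, EF1, EF2, EF3, EF4, EF5}

/-- Markov's principle `∀ x, ¬¬ P(x) → P(x)`. -/
def markov : Fml EFLang := .alls 1 (¬ᵢ ¬ᵢ P (v 0) ⇒ᵢ P (v 0))

end EF

/-! ### The geometrical theory EG -/

/-- Relation symbols of geometry: strict betweenness and equidistance. -/
inductive GeoRel : ℕ → Type where
  | betw : GeoRel 3
  | cong : GeoRel 4

/-- The language of geometry; there are no function symbols. -/
def GeoLang : FirstOrder.Language.{0, 0} := ⟨fun _ => Empty, GeoRel⟩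

namespace EG

/-! The arguments of the following abbreviations are (de Bruijn indices of) variables. -/

/-- `a = b`. -/
def same (a b : ℕ) : Fml GeoLang := .eq (.var a) (.var b)

/-- Strict betweenness `B(a,b,c)`. -/
def B (a b c : ℕ) : Fml GeoLang := .rel (n := 3) GeoRel.betw ![.var a, .var b, .var c]

/-- `E(a,b,c,d)`, i.e. `ab = cd`. -/
def E (a b c d : ℕ) : Fml GeoLang := .rel (n := 4) GeoRel.cong ![.var a, .var b, .var c, .var d]

/-- `a # b := ∃ c, B(c,a,b) ∨ B(a,c,b) ∨ B(a,b,c)`. -/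
def distinct (a b : ℕ) : Fml GeoLang :=
  .ex (B 0 (a + 1) (b + 1) ∨ᵢ B (a + 1) 0 (b + 1) ∨ᵢ B (a + 1) (b + 1) 0)

/-- `R(a,b,c) := ∃ d, B(a,b,d) ∧ ab = bd ∧ ac = dc ∧ a # b ∧ c # b ∧ a # c`. -/
def R (a b c : ℕ) : Fml GeoLang :=
  .ex (B (a + 1) (b + 1) 0 ∧ᵢ E (a + 1) (b + 1) (b + 1) 0 ∧ᵢ E (a + 1) (c + 1) 0 (c + 1) ∧ᵢ
    distinct (a + 1) (b + 1) ∧ᵢ distinct (c + 1) (b + 1) ∧ᵢ distinct (a + 1) (c + 1))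

/-- `x` lies on the ray from `a` through `b`:
`Ray(a,b,x) := ∃ d, B(d,a,b) ∧ B(d,a,x)`. -/
def Ray (a b x : ℕ) : Fml GeoLang := .ex (B 0 (a + 1) (b + 1) ∧ᵢ B 0 (a + 1) (x + 1))

/-- `apex(a,b,c) := ∃ u v, Ray(b,a,u) ∧ Ray(b,c,v) ∧ bu = bv ∧ u # v`. -/
def apex (a b c : ℕ) : Fml GeoLang :=
  let u := 1
  let v := 0
  .exs 2 (Ray (b + 2) (a + 2) u ∧ᵢ Ray (b + 2) (c + 2) v ∧ᵢ E (b + 2) u (b + 2) v ∧ᵢ distinct u v)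

/-- `∠abc = ∠a'b'c' := ∃ u v u' v', Ray(b,a,u) ∧ Ray(b,c,v) ∧ Ray(b',a',u') ∧ Ray(b',c',v') ∧`
`bu = b'u' ∧ bv = b'v' ∧ uv = u'v'`. -/
def angleCong (a b c a' b' c' : ℕ) : Fml GeoLang :=
  let u := 3
  let v := 2
  let u' := 1
  let v' := 0
  .exs 4 (Ray (b + 4) (a + 4) u ∧ᵢ Ray (b + 4) (c + 4) v ∧ᵢ
    Ray (b' + 4) (a' + 4) u' ∧ᵢ Ray (b' + 4) (c' + 4) v' ∧ᵢ
    E (b + 4) u (b' + 4) u' ∧ᵢ E (b + 4) v (b' + 4) v' ∧ᵢ E u v u' v')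

/-- `0 < abc := apex(a,b,c) ∨ R(a,b,c) ∨`
`∃ a' b' c', ∠abc = ∠a'b'c' ∧ (R(b',a',c') ∨ R(a',c',b'))`. -/
def posAngle (a b c : ℕ) : Fml GeoLang :=
  let a' := 2
  let b' := 1
  let c' := 0
  apex a b c ∨ᵢ R a b c ∨ᵢ
    .exs 3 (angleCong (a + 3) (b + 3) (c + 3) a' b' c' ∧ᵢ (R b' a' c' ∨ᵢ R a' c' b'))

/-- `abc < π := ∃ d, B(d,b,a) ∧ 0 < dbc`. -/
def ltPi (a b c : ℕ) : Fml GeoLang := .ex (B 0 (b + 1) (a + 1) ∧ᵢ posAngle 0 (b + 1) (c + 1))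

/-- `0 < abc < π`. -/
def properAngle (a b c : ℕ) : Fml GeoLang := posAngle a b c ∧ᵢ ltPi a b c

/-- Non-strict betweenness `T(a,b,c) := ¬ (a ≠ b ∧ ¬ B(a,b,c) ∧ b ≠ c)`. -/
def T (a b c : ℕ) : Fml GeoLang := ¬ᵢ (¬ᵢ same a b ∧ᵢ ¬ᵢ B a b c ∧ᵢ ¬ᵢ same b c)

/-- Collinearity
`L(a,b,c) := ¬¬ (B(c,a,b) ∨ c = a ∨ B(a,c,b) ∨ c = b ∨ B(a,b,c))`. -/
def L (a b c : ℕ) : Fml GeoLang :=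
  ¬ᵢ ¬ᵢ (B c a b ∨ᵢ same c a ∨ᵢ B a c b ∨ᵢ same c b ∨ᵢ B a b c)

/-- `ab = ba` -/
def congRefl : Fml GeoLang := .alls 2 (E 0 1 1 0)

/-- `ab = pq ∧ ab = rs → pq = rs` -/
def congTrans : Fml GeoLang := .alls 6 (E 0 1 2 3 ∧ᵢ E 0 1 4 5 ⇒ᵢ E 2 3 4 5)

/-- `ab = cc → a = b` -/
def congIdentity : Fml GeoLang := .alls 3 (E 0 1 2 2 ⇒ᵢ same 0 1)

/-- `¬¬ ab = cd → ab = cd` -/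
def congStable : Fml GeoLang := .alls 4 (¬ᵢ ¬ᵢ E 0 1 2 3 ⇒ᵢ E 0 1 2 3)

/-- `¬ B(a,b,a)` -/
def betwIdentity : Fml GeoLang := .alls 2 (¬ᵢ B 0 1 0)

/-- `B(a,b,c) → B(c,b,a)` -/
def betwSymm : Fml GeoLang := .alls 3 (B 0 1 2 ⇒ᵢ B 2 1 0)

/-- `B(a,b,d) ∧ B(b,c,d) → B(a,b,c)` -/
def innerTrans : Fml GeoLang :=
  let a := 0
  let b := 1
  let c := 2
  let d := 3
  .alls 4 (B a b d ∧ᵢ B b c d ⇒ᵢ B a b c)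

/-- `B(a,b,d) ∧ B(a,c,d) ∧ ¬ B(a,b,c) ∧ ¬ B(a,c,b) → b = c` -/
def connectivity : Fml GeoLang :=
  let a := 0
  let b := 1
  let c := 2
  let d := 3
  .alls 4 (B a b d ∧ᵢ B a c d ∧ᵢ ¬ᵢ B a b c ∧ᵢ ¬ᵢ B a c b ⇒ᵢ same b c)

/-- `a' # b' ∧ ab = a'b' → ∃ e, T(a,b,e) ∧ be = cd` -/
def extension : Fml GeoLang :=
  let a := 0
  let b := 1
  let c := 2
  let d := 3
  let a' := 4
  let b' := 5
  .alls 6 (distinct a' b' ∧ᵢ E a b a' b' ⇒ᵢ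
    .ex (T (a + 1) (b + 1) 0 ∧ᵢ E (b + 1) 0 (c + 1) (d + 1)))

/-- `a' # b' ∧ ab = a'b' ∧ c' # d' ∧ cd = c'd' → ∃ e, B(a,b,e) ∧ be = cd` -/
def strictExtension : Fml GeoLang :=
  let a := 0
  let b := 1
  let c := 2
  let d := 3
  let a' := 4
  let b' := 5
  let c' := 6
  let d' := 7
  .alls 8 (distinct a' b' ∧ᵢ E a b a' b' ∧ᵢ distinct c' d' ∧ᵢ E c d c' d' ⇒ᵢ
    .ex (B (a + 1) (b + 1) 0 ∧ᵢ E (b + 1) 0 (c + 1) (d + 1)))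

/-- `a # b ∧ T(a,b,c) ∧ T(a',b',c') ∧ ab = a'b' ∧ bc = b'c' ∧ ad = a'd' ∧ bd = b'd' → cd = c'd'` -/
def fiveSegment : Fml GeoLang :=
  let a := 0
  let b := 1
  let c := 2
  let d := 3
  let a' := 4
  let b' := 5
  let c' := 6
  let d' := 7
  .alls 8 (distinct a b ∧ᵢ T a b c ∧ᵢ T a' b' c' ∧ᵢ E a b a' b' ∧ᵢ E b c b' c' ∧ᵢ E a d a' d' ∧ᵢ
    E b d b' d' ⇒ᵢ E c d c' d')

/-- `B(a,p,c) ∧ B(b,q,c) ∧ (0 < acb < π ∨ 0 < qpa < π) → ∃ x, B(p,x,b) ∧ B(a,x,q)` -/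
def innerPasch : Fml GeoLang :=
  let a := 0
  let b := 1
  let c := 2
  let p := 3
  let q := 4
  .alls 5 (B a p c ∧ᵢ B b q c ∧ᵢ (properAngle a c b ∨ᵢ properAngle q p a) ⇒ᵢ
    .ex (B (p + 1) 0 (b + 1) ∧ᵢ B (a + 1) 0 (q + 1)))

/-- `B(a,p,c) ∧ B(b,c,q) ∧ (0 < baq < π ∨ 0 < abq < π) → ∃ x, B(b,p,x) ∧ B(a,x,q)` -/
def outerPasch : Fml GeoLang :=
  let a := 0
  let b := 1
  let c := 2
  let p := 3
  let q := 4
  .alls 5 (B a p c ∧ᵢ B b c q ∧ᵢ (properAngle b a q ∨ᵢ properAngle a b q) ⇒ᵢ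
    .ex (B (b + 1) (p + 1) 0 ∧ᵢ B (a + 1) 0 (q + 1)))

/-- The lower dimension law: there are points `α, β, γ, c₁, c₂, c₃, c₄` with
`αβ = βγ ∧ αβ = αγ ∧ α ≠ β`, with `c₁, c₂, c₃` the midpoints of `αβ`, `αγ`, `βγ`,
and with `B(β,c₄,c₂) ∧ B(γ,c₄,c₁)`. -/
def lowerDimension : Fml GeoLang :=
  let α := 0
  let β := 1
  let γ := 2
  let c₁ := 3
  let c₂ := 4
  let c₃ := 5
  let c₄ := 6
  .exs 7 (E α β β γ ∧ᵢ E α β α γ ∧ᵢ ¬ᵢ same α β ∧ᵢ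
    (B α c₁ β ∧ᵢ E α c₁ c₁ β) ∧ᵢ (B α c₂ γ ∧ᵢ E α c₂ c₂ γ) ∧ᵢ (B β c₃ γ ∧ᵢ E β c₃ c₃ γ) ∧ᵢ
    (B β c₄ c₂ ∧ᵢ B γ c₄ c₁))

/-- Line-circle continuity: if `a` lies strictly inside the circle with center `c` and radius `pq`
(between the ends of a diameter `uv`) and `a # b`, then the line `ab` meets the circle in two points
`x`, `y` with `B(x,a,y)`. -/
def lineCircle : Fml GeoLang :=
  let a := 0
  let b := 1
  let c := 2
  let p := 3
  let q := 4
  let u := 5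
  let v := 6
  let x := 1
  let y := 0
  .alls 7 (distinct a b ∧ᵢ B u a v ∧ᵢ E c u p q ∧ᵢ E c v p q ∧ᵢ B u c v ⇒ᵢ
    .exs 2 (E (c + 2) x (p + 2) (q + 2) ∧ᵢ E (c + 2) y (p + 2) (q + 2) ∧ᵢ B x (a + 2) y ∧ᵢ
      L (a + 2) (b + 2) x ∧ᵢ L (a + 2) (b + 2) y))

/-- Non-strict line-circle continuity: the same with `T` in place of `B`. -/
def lineCircleNonstrict : Fml GeoLang :=
  let a := 0
  let b := 1
  let c := 2
  let p := 3
  let q := 4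
  let u := 5
  let v := 6
  let x := 1
  let y := 0
  .alls 7 (distinct a b ∧ᵢ T u a v ∧ᵢ E c u p q ∧ᵢ E c v p q ∧ᵢ T u c v ⇒ᵢ
    .exs 2 (E (c + 2) x (p + 2) (q + 2) ∧ᵢ E (c + 2) y (p + 2) (q + 2) ∧ᵢ T x (a + 2) y ∧ᵢ
      L (a + 2) (b + 2) x ∧ᵢ L (a + 2) (b + 2) y))

/-- Circle-circle continuity, with the circle of center `c` and radius `pq` having a point `a`
non-strictly inside, and a point `b` strictly outside, the circle of center `c'` and radius `p'q'`:
`ca = pq ∧ T(u,a,v) ∧ T(u,c',v) ∧ c'u = p'q' ∧ c'v = p'q' ∧`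
`cb = pq ∧ B(c',w,b) ∧ c'w = p'q' → ∃ e, ce = pq ∧ c'e = p'q'`. -/
def circleCircle : Fml GeoLang :=
  let a := 0
  let b := 1
  let c := 2
  let p := 3
  let q := 4
  let u := 5
  let v := 6
  let w := 7
  let c' := 8
  let p' := 9
  let q' := 10
  .alls 11 (E c a p q ∧ᵢ T u a v ∧ᵢ T u c' v ∧ᵢ E c' u p' q' ∧ᵢ E c' v p' q' ∧ᵢ
    E c b p q ∧ᵢ B c' w b ∧ᵢ E c' w p' q' ⇒ᵢ
    .ex (E (c + 1) 0 (p + 1) (q + 1) ∧ᵢ E (c' + 1) 0 (p' + 1) (q' + 1)))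

/-- Circle-circle continuity for circles with distinct centers, with `b` non-strictly outside. -/
def circleCircleNonstrict : Fml GeoLang :=
  let a := 0
  let b := 1
  let c := 2
  let p := 3
  let q := 4
  let u := 5
  let v := 6
  let w := 7
  let c' := 8
  let p' := 9
  let q' := 10
  .alls 11 (distinct c c' ∧ᵢ E c a p q ∧ᵢ T u a v ∧ᵢ T u c' v ∧ᵢ E c' u p' q' ∧ᵢ E c' v p' q' ∧ᵢ
    E c b p q ∧ᵢ T c' w b ∧ᵢ E c' w p' q' ⇒ᵢ
    .ex (E (c + 1) 0 (p + 1) (q + 1) ∧ᵢ E (c' + 1) 0 (p' + 1) (q' + 1)))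

/-- Euclid 5. The hypotheses `p # a` and `s # q` say that the two lines which are to meet are
determined: `p # a ∧ s # q ∧ pt = qt ∧ B(p,t,q) ∧ st = rt ∧ B(s,t,r) ∧ pr = qs ∧ B(q,a,r) →`
`∃ e, B(p,a,e) ∧ B(s,q,e)`. -/
def euclid5 : Fml GeoLang :=
  let a := 0
  let p := 1
  let q := 2
  let r := 3
  let s := 4
  let t := 5
  .alls 6 (distinct p a ∧ᵢ distinct s q ∧ᵢ E p t q t ∧ᵢ B p t q ∧ᵢ E s t r t ∧ᵢ B s t r ∧ᵢ
    E p r q s ∧ᵢ B q a r ⇒ᵢ .ex (B (p + 1) (a + 1) 0 ∧ᵢ B (s + 1) (q + 1) 0))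

/-- The theory EG of Euclidean geometry without Markov's principle. -/
def theory : Set (Fml GeoLang) :=
  { congRefl, congTrans, congIdentity, congStable, betwIdentity, betwSymm, innerTrans, connectivity,
    extension, strictExtension, fiveSegment, innerPasch, outerPasch, lowerDimension, lineCircle,
    lineCircleNonstrict, circleCircle, circleCircleNonstrict, euclid5 }

/-- Markov's principle `∀ a b c, ¬¬ B(a,b,c) → B(a,b,c)`. -/
def markov : Fml GeoLang := .alls 3 (¬ᵢ ¬ᵢ B 0 1 2 ⇒ᵢ B 0 1 2)

end EG

/-! ### Structures: rings with a positivity predicate, and the planes over them -/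

/-- A commutative ring with a predicate `pos` as a structure for the language of Euclidean fields. -/
abbrev efStructure (R : Type u) [CommRing R] (pos : R → Prop) : EFLang.Structure R where
  funMap {n} f := match n, (f : EFFunc n) with
    | _, .zero => fun _ => 0
    | _, .one => fun _ => 1
    | _, .neg => fun x => - x 0
    | _, .add => fun x => x 0 + x 1
    | _, .mul => fun x => x 0 * x 1
  RelMap {n} r := match n, (r : EFRel n) with
    | _, .pos => fun x => pos (x 0)

/-- Dot product in the plane. -/
def dot {R : Type u} [CommRing R] (x y : R × R) : R := x.1 * y.1 + x.2 * y.2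

/-- Cross product in the plane. -/
def cross {R : Type u} [CommRing R] (x y : R × R) : R := x.1 * y.2 - x.2 * y.1

/-- The plane over a commutative ring with a positivity predicate, as a geometrical structure:
`B(a,b,c)` means `(c - b) × (b - a) = 0` and `(b - c) · (a - b)` is positive, and `E(a,b,c,d)`
means `(b - a)² = (d - c)²`. -/
abbrev planeStructure (R : Type u) [CommRing R] (pos : R → Prop) : GeoLang.Structure (R × R) where
  funMap {_} f := Empty.elim f
  RelMap {n} r := match n, (r : GeoRel n) with
    | _, .betw => fun x => cross (x 2 - x 1) (x 1 - x 0) = 0 ∧ pos (dot (x 1 - x 2) (x 0 - x 1))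
    | _, .cong => fun x => dot (x 1 - x 0) (x 1 - x 0) = dot (x 3 - x 2) (x 3 - x 2)

/-! ### The two-node models over an ordered field -/

section TwoNode

variable (F : Type u) [Field F] [LinearOrder F] [IsStrictOrderedRing F]

/-- The ring `F₀` of finitely bounded elements of `F`. -/
def finiteSubring : Subring F where
  carrier := {x | ∃ n : ℕ, |x| ≤ n}
  mul_mem' := by
    rintro a b ⟨n, hn⟩ ⟨m, hm⟩
    refine ⟨n * m, ?_⟩
    rw [abs_mul]
    push_cast
    exact mul_le_mul hn hm (abs_nonneg b) (Nat.cast_nonneg n)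
  one_mem' := ⟨1, by simp⟩
  add_mem' := by
    rintro a b ⟨n, hn⟩ ⟨m, hm⟩
    refine ⟨n + m, (abs_add_le a b).trans ?_⟩
    push_cast
    exact add_le_add hn hm
  zero_mem' := ⟨0, by simp⟩
  neg_mem' := by
    rintro a ⟨n, hn⟩
    exact ⟨n, by rwa [abs_neg]⟩

variable {F}

/-- `x` is infinitesimal: it is zero or its reciprocal is not finitely bounded. -/
def IsInfinitesimal (x : F) : Prop := x = 0 ∨ x⁻¹ ∉ finiteSubring F

variable (F)

/-- The universes of the two nodes: `F₀` at the root `false`, and `F` at the upper node `true`. -/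
def Node : Bool → Type u
  | false => finiteSubring F
  | true => F

instance (w : Bool) : CommRing (Node F w) :=
  match w with
  | false => inferInstanceAs (CommRing (finiteSubring F))
  | true => inferInstanceAs (CommRing F)

/-- The interpretation of `P` at the two nodes: positive in `F` and not infinitesimal at the root,
positive at the upper node. -/
def nodePos : (w : Bool) → Node F w → Prop
  | false => fun x : finiteSubring F => 0 < (x : F) ∧ ¬ IsInfinitesimal (x : F)
  | true => fun x : F => 0 < x

/-- The inclusions between the nodes. -/
def nodeMap : {w v : Bool} → w ≤ v → (Node F w →+* Node F v)
  | false, false, _ => RingHom.id (finiteSubring F)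
  | false, true, _ => (finiteSubring F).subtype
  | true, true, _ => RingHom.id F

theorem nodeMap_pos {w v : Bool} (h : w ≤ v) (x : Node F w) (hx : nodePos F w x) :
    nodePos F v (nodeMap F h x) := by
  cases w <;> cases v
  · exact hx
  · exact hx.1
  · exact absurd h (by decide)
  · exact hx

theorem nodeMap_refl (w : Bool) (x : Node F w) : nodeMap F (le_refl w) x = x := by
  cases w <;> rfl

theorem nodeMap_trans {w v z : Bool} (h : w ≤ v) (h' : v ≤ z) (x : Node F w) :
    nodeMap F (h.trans h') x = nodeMap F h' (nodeMap F h x) := by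
  cases w <;> cases v <;> cases z <;> first
    | rfl
    | exact absurd h (by decide)
    | exact absurd h' (by decide)

/-- The two-node Kripke model for the language of Euclidean fields, with root `F₀` and upper
node `F`. -/
def fieldModel : KripkeModel.{u} EFLang Bool where
  carrier := Node F
  str w := efStructure (Node F w) (nodePos F w)
  nonempty _ := ⟨0⟩
  map {w v} h :=
    letI := efStructure (Node F w) (nodePos F w)
    letI := efStructure (Node F v) (nodePos F v)
    { toFun := nodeMap F h
      map_fun' := by
        intro n f x
        cases (f : EFFunc n)
        · exact map_zero (nodeMap F h)
        · exact map_one (nodeMap F h)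
        · exact map_neg (nodeMap F h) _
        · exact map_add (nodeMap F h) _ _
        · exact map_mul (nodeMap F h) _ _
      map_rel' := by
        intro n r x hx
        cases (r : EFRel n)
        exact nodeMap_pos F h _ hx }
  map_refl w x := nodeMap_refl F w x
  map_trans h h' x := nodeMap_trans F h h' x

/-- The two-node Kripke model for the language of geometry, with root the plane over `F₀` and upper
node the plane over `F`. -/
def planeModel : KripkeModel.{u} GeoLang Bool where
  carrier w := Node F w × Node F w
  str w := planeStructure (Node F w) (nodePos F w)
  nonempty _ := ⟨0⟩
  map {w v} h :=
    letI := planeStructure (Node F w) (nodePos F w)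
    letI := planeStructure (Node F v) (nodePos F v)
    { toFun := Prod.map (nodeMap F h) (nodeMap F h)
      map_fun' := by
        intro n f x
        exact Empty.elim f
      map_rel' := by
        intro n r x hx
        cases (r : GeoRel n)
        · obtain ⟨h₁, h₂⟩ := hx
          refine ⟨?_, ?_⟩
          · have := congrArg (nodeMap F h) h₁
            simpa [cross] using this
          · have := nodeMap_pos F h _ h₂
            simpa [dot] using this
        · have := congrArg (nodeMap F h) hx
          show dot _ _ = dot _ _
          simpa [dot] using this }
  map_refl w x := Prod.ext (nodeMap_refl F w x.1) (nodeMap_refl F w x.2)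
  map_trans h h' x := Prod.ext (nodeMap_trans F h h' x.1) (nodeMap_trans F h h' x.2)

end TwoNode

/-! Kripke forcing is sound for intuitionistic provability, so it suffices that the two-node models
force every axiom at both nodes while the root fails to force Markov's principle. The failure comes
from a positive infinitesimal `x`. The upper node sees `x > 0`, so the root forces `¬¬P(x)`; but
`x⁻¹` is infinite, so the root does not force `P(x)`. In the plane, the points `(0,0)`, `(1,0)`,
`(1+x,0)` play the same role. The hyperreals supply a suitable field.

For the axioms, both nodes are treated at once. Each is an order-convex subring `R` of `F`
(`finiteSubring F` or `⊤`), and `P` means "positive and a unit of `R`" (`UnitPos`; below,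
"appreciable"). Convexity has two main consequences: a square root taken in `F` of an element of `R`
lies in `R` (`mem_of_mul_self_mem`), and anything in `R` above an appreciable element is appreciable
(`UnitPos.mono`). Each axiom then becomes a computation in `F` whose divisions are by appreciable
quantities and whose square roots stay in `R`.

Negations are decided at the upper node (`forces_neg_iff`), so `T`, `L` and negated betweenness have
their classical meaning in `F × F`, while `a # b` says that `distSq a b` is appreciable
(`forces_distinct`). The delicate axioms are the two Pasch laws. Writing `r`, `s` for the lengths of
the sides of an angle, `0 < abc` makes `r * s - dot` appreciable and `abc < π` makes `r * s + dot`
appreciable. Their product is the squared cross product (`cross_of_dirApart`), and this is the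
nondegeneracy that the intersection points need. -/

set_option linter.unusedSectionVars false

/-! ### Soundness of Kripke models -/

namespace KripkeModel

variable {L : FirstOrder.Language.{0, 0}} {W : Type} [Preorder W] (M : KripkeModel.{u} L W)

theorem map_comp_extend {w v : W} (h : w ≤ v) (x : M.carrier w) (ρ : ℕ → M.carrier w) :
    (fun n => M.map h (extend x ρ n)) = extend (M.map h x) fun n => M.map h (ρ n) := by
  funext n
  cases n <;> rfl

theorem realize_map {w v : W} (h : w ≤ v) (ρ : ℕ → M.carrier w) (t : L.Term ℕ) :
    t.realize (fun n => M.map h (ρ n)) = M.map h (t.realize ρ) :=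
  FirstOrder.Language.HomClass.realize_term (M.map h)

theorem forces_mono (φ : Fml L) {w v : W} (h : w ≤ v) (ρ : ℕ → M.carrier w)
    (hφ : M.Forces φ w ρ) : M.Forces φ v fun n => M.map h (ρ n) := by
  induction φ generalizing w v with
  | falsum => exact hφ
  | eq t s =>
    simp only [Forces] at hφ ⊢
    rw [realize_map, realize_map, hφ]
  | rel R ts =>
    simp only [Forces] at hφ ⊢
    simp only [realize_map]
    exact (M.map h).map_rel R _ hφ
  | and φ ψ ihφ ihψ => exact ⟨ihφ h ρ hφ.1, ihψ h ρ hφ.2⟩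
  | or φ ψ ihφ ihψ => exact hφ.imp (ihφ h ρ) (ihψ h ρ)
  | imp φ ψ _ _ =>
    intro z hz
    have := hφ z (h.trans hz)
    simpa only [M.map_trans h hz] using this
  | all φ _ =>
    intro z hz x
    have := hφ z (h.trans hz) x
    simpa only [M.map_trans h hz] using this
  | ex φ ih =>
    obtain ⟨x, hx⟩ := hφ
    refine ⟨M.map h x, ?_⟩
    have := ih h _ hx
    rwa [map_comp_extend] at this

theorem realize_liftSubst {w : W} (σ : ℕ → L.Term ℕ) (x : M.carrier w) (ρ : ℕ → M.carrier w) :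
    (fun n => (Fml.liftSubst σ n).realize (extend x ρ)) =
      extend x fun n => (σ n).realize ρ := by
  funext n
  cases n with
  | zero => rfl
  | succ n =>
    simp only [Fml.liftSubst, FirstOrder.Language.Term.realize_relabel]
    rfl

theorem forces_subst (φ : Fml L) (σ : ℕ → L.Term ℕ) {w : W} (ρ : ℕ → M.carrier w) :
    M.Forces (φ.subst σ) w ρ ↔ M.Forces φ w fun n => (σ n).realize ρ := by
  induction φ generalizing w σ with
  | falsum => exact Iff.rfl
  | eq t s => simp only [Fml.subst, Forces, FirstOrder.Language.Term.realize_subst]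
  | rel R ts => simp only [Fml.subst, Forces, FirstOrder.Language.Term.realize_subst]
  | and φ ψ ihφ ihψ => simp only [Fml.subst, Forces, ihφ, ihψ]
  | or φ ψ ihφ ihψ => simp only [Fml.subst, Forces, ihφ, ihψ]
  | imp φ ψ ihφ ihψ => simp only [Fml.subst, Forces, ihφ, ihψ, realize_map]
  | all φ ih => simp only [Fml.subst, Forces, ih, realize_liftSubst, realize_map]
  | ex φ ih => simp only [Fml.subst, Forces, ih, realize_liftSubst]

theorem forces_shift (φ : Fml L) {w : W} (x : M.carrier w) (ρ : ℕ → M.carrier w) :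
    M.Forces φ.shift w (extend x ρ) ↔ M.Forces φ w ρ :=
  M.forces_subst φ _ _

theorem forces_inst (φ : Fml L) (t : L.Term ℕ) {w : W} (ρ : ℕ → M.carrier w) :
    M.Forces (φ.inst t) w ρ ↔ M.Forces φ w (extend (t.realize ρ) ρ) := by
  rw [Fml.inst, forces_subst]
  have : (fun n => FirstOrder.Language.Term.realize ρ
      (Nat.casesOn n t fun m => .var m : L.Term ℕ)) = extend (t.realize ρ) ρ := by
    funext n
    cases n <;> rfl
  rw [this]

theorem map_refl_comp {w : W} (ρ : ℕ → M.carrier w) :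
    (fun n => M.map (le_refl w) (ρ n)) = ρ :=
  funext fun n => M.map_refl w (ρ n)

/-- Intuitionistic provability is sound for forcing. -/
theorem soundness {Γ : Set (Fml L)} {φ : Fml L} (h : Provable Γ φ) {w : W}
    (ρ : ℕ → M.carrier w) (hΓ : ∀ γ ∈ Γ, M.Forces γ w ρ) : M.Forces φ w ρ := by
  have hins : ∀ {Δ : Set (Fml L)} {χ : Fml L} {v : W} {τ : ℕ → M.carrier v},
      M.Forces χ v τ → (∀ γ ∈ Δ, M.Forces γ v τ) → ∀ γ ∈ insert χ Δ, M.Forces γ v τ := by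
    rintro Δ χ v τ hχ hΔ γ (rfl | hγ)
    exacts [hχ, hΔ γ hγ]
  have hsh : ∀ {Δ : Set (Fml L)} {v : W} {τ : ℕ → M.carrier v} (x : M.carrier v),
      (∀ γ ∈ Δ, M.Forces γ v τ) → ∀ γ ∈ Fml.shift '' Δ, M.Forces γ v (extend x τ) := by
    rintro Δ v τ x hΔ _ ⟨γ, hγ, rfl⟩
    exact (M.forces_shift γ x τ).2 (hΔ γ hγ)
  induction h generalizing w with
  | hyp h => exact hΓ _ h
  | falsumE _ ih => exact (ih ρ hΓ).elim
  | andI _ _ ih₁ ih₂ => exact ⟨ih₁ ρ hΓ, ih₂ ρ hΓ⟩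
  | andE₁ _ ih => exact (ih ρ hΓ).1
  | andE₂ _ ih => exact (ih ρ hΓ).2
  | orI₁ _ ih => exact .inl (ih ρ hΓ)
  | orI₂ _ ih => exact .inr (ih ρ hΓ)
  | orE _ _ _ ih ih₁ ih₂ =>
    rcases ih ρ hΓ with h | h
    exacts [ih₁ ρ (hins h hΓ), ih₂ ρ (hins h hΓ)]
  | impI _ ih =>
    intro v hv hφ
    exact ih _ (hins hφ fun γ hγ => M.forces_mono γ hv ρ (hΓ γ hγ))
  | impE _ _ ih₁ ih₂ =>
    have := ih₁ ρ hΓ w le_rfl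
    rw [map_refl_comp] at this
    exact this (ih₂ ρ hΓ)
  | allI _ ih =>
    intro v hv x
    exact ih _ (hsh x fun γ hγ => M.forces_mono γ hv ρ (hΓ γ hγ))
  | allE t _ ih =>
    have := ih ρ hΓ w le_rfl (t.realize ρ)
    rw [map_refl_comp] at this
    exact (M.forces_inst _ t ρ).2 this
  | exI t _ ih => exact ⟨t.realize ρ, (M.forces_inst _ t ρ).1 (ih ρ hΓ)⟩
  | exE _ _ ih₁ ih₂ =>
    obtain ⟨x, hx⟩ := ih₁ ρ hΓ
    exact (M.forces_shift _ x ρ).1 (ih₂ _ (hins hx (hsh x hΓ)))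
  | eqRefl t => rfl
  | eqSubst _ _ ih₁ ih₂ =>
    have h₁ := ih₁ ρ hΓ
    have h₂ := (M.forces_inst _ _ ρ).1 (ih₂ ρ hΓ)
    rw [show _ = _ from h₁] at h₂
    exact (M.forces_inst _ _ ρ).2 h₂

theorem IsModelOf.satisfies_of_provable {M : KripkeModel.{u} L W} {T : Set (Fml L)} {φ : Fml L}
    (hM : M.IsModelOf T) (h : Provable T φ) (w : W) : M.Satisfies w φ :=
  fun ρ => M.soundness h ρ fun γ hγ => hM γ hγ w ρ

/-- The hypothesis ranges over all nodes because a quantifier forced at `w` speaks about the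
elements of every later node. With `satisfies_imp` it lets an axiom be checked at one arbitrary node
at a time. -/
theorem satisfies_alls {φ : Fml L} (n : ℕ) (h : ∀ w, M.Satisfies w φ) (w : W) :
    M.Satisfies w (.alls n φ) := by
  induction n generalizing φ with
  | zero => exact h w
  | succ n ih => exact ih fun _ _ v _ _ => h v _

theorem satisfies_imp {φ ψ : Fml L} (h : ∀ w ρ, M.Forces φ w ρ → M.Forces ψ w ρ) (w : W) :
    M.Satisfies w (φ ⇒ᵢ ψ) :=
  fun _ v _ => h v _

theorem satisfies_alls_imp {φ ψ : Fml L} (n : ℕ)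
    (h : ∀ w ρ, M.Forces φ w ρ → M.Forces ψ w ρ) (w : W) :
    M.Satisfies w (.alls n (φ ⇒ᵢ ψ)) :=
  M.satisfies_alls n (M.satisfies_imp h) w

end KripkeModel

/-! ### Convex subrings of an ordered field -/

section ConvexSubring

variable {F : Type u} [Field F] [LinearOrder F] [IsStrictOrderedRing F]

/-- An order-convex subring of an ordered field. -/
def IsConvexSubring (R : Subring F) : Prop := ∀ ⦃x y : F⦄, y ∈ R → |x| ≤ |y| → x ∈ R

/-- `x` is positive and a unit of the subring `R`. -/
def UnitPos (R : Subring F) (x : F) : Prop := 0 < x ∧ x ∈ R ∧ x⁻¹ ∈ R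

theorem isConvexSubring_top : IsConvexSubring (⊤ : Subring F) := fun _ _ _ _ => trivial

theorem isConvexSubring_finiteSubring : IsConvexSubring (finiteSubring F) :=
  fun _ _ ⟨n, hn⟩ h => ⟨n, h.trans hn⟩

theorem unitPos_top {x : F} : UnitPos ⊤ x ↔ 0 < x := ⟨fun h => h.1, fun h => ⟨h, trivial, trivial⟩⟩

namespace IsConvexSubring

variable {R : Subring F} (hR : IsConvexSubring R)
include hR

theorem mem_of_le {x y : F} (hx : 0 ≤ x) (hxy : x ≤ y) (hy : y ∈ R) : x ∈ R :=
  hR hy (by rwa [abs_of_nonneg hx, abs_of_nonneg (hx.trans hxy)])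

/-- By `|x| ≤ 1 + x * x` and convexity. This keeps square roots inside the node. -/
theorem mem_of_mul_self_mem {x : F} (h : x * x ∈ R) : x ∈ R := by
  refine hR (R.add_mem R.one_mem h) ?_
  rw [abs_of_nonneg (_root_.add_nonneg zero_le_one (mul_self_nonneg x))]
  rw [abs_le]
  constructor <;> nlinarith [sq_nonneg (x - 1), sq_nonneg (x + 1)]

end IsConvexSubring

namespace UnitPos

variable {R : Subring F} {x y : F}

theorem one : UnitPos R 1 := ⟨one_pos, R.one_mem, by simp⟩

theorem mul (hx : UnitPos R x) (hy : UnitPos R y) : UnitPos R (x * y) :=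
  ⟨mul_pos hx.1 hy.1, R.mul_mem hx.2.1 hy.2.1, by
    rw [mul_inv]
    exact R.mul_mem hx.2.2 hy.2.2⟩

theorem inv (hx : UnitPos R x) : UnitPos R x⁻¹ :=
  ⟨inv_pos.2 hx.1, hx.2.2, by simpa using hx.2.1⟩

theorem div (hx : UnitPos R x) (hy : UnitPos R y) : UnitPos R (x / y) := by
  rw [div_eq_mul_inv]
  exact hx.mul hy.inv

theorem div_mem (hx : x ∈ R) (hy : UnitPos R y) : x / y ∈ R := by
  rw [div_eq_mul_inv]
  exact R.mul_mem hx hy.2.2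

/-- Since `y⁻¹ = x * (x * y)⁻¹`, the factor `x` need not be known to be a unit. Appreciable factors
are repeatedly extracted from appreciable products this way. -/
theorem of_mul (hx : 0 < x) (hxR : x ∈ R) (hy : y ∈ R) (h : UnitPos R (x * y)) : UnitPos R y := by
  refine ⟨(pos_iff_pos_of_mul_pos h.1).1 hx, hy, ?_⟩
  have : y⁻¹ = x * (x * y)⁻¹ := by
    rw [mul_inv, mul_inv_cancel_left₀ hx.ne']
  rw [this]
  exact R.mul_mem hxR h.2.2

/-- Inversion reverses the order, so `y⁻¹` lies between `0` and `x⁻¹`. -/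
theorem mono (hR : IsConvexSubring R) (hx : UnitPos R x) (hxy : x ≤ y) (hy : y ∈ R) :
    UnitPos R y := by
  have h := hx.1.trans_le hxy
  exact ⟨h, hy, hR.mem_of_le (inv_nonneg.2 h.le) (inv_anti₀ hx.1 hxy) hx.2.2⟩

theorem add_nonneg (hR : IsConvexSubring R) (hx : UnitPos R x) (hy : 0 ≤ y) (hyR : y ∈ R) :
    UnitPos R (x + y) :=
  hx.mono hR (by linarith) (R.add_mem hx.2.1 hyR)

theorem add (hR : IsConvexSubring R) (hx : UnitPos R x) (hy : UnitPos R y) : UnitPos R (x + y) :=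
  hx.add_nonneg hR hy.1.le hy.2.1

theorem of_mul_self (hR : IsConvexSubring R) (hx : 0 < x) (h : UnitPos R (x * x)) :
    UnitPos R x :=
  have hxR := hR.mem_of_mul_self_mem h.2.1
  of_mul hx hxR hxR h

theorem natCast (hR : IsConvexSubring R) {n : ℕ} (hn : 1 ≤ n) : UnitPos R (n : F) :=
  one.mono hR (by exact_mod_cast hn) (natCast_mem R n)

end UnitPos

end ConvexSubring

/-! ### Plane geometry over a convex subring -/

section Plane

variable {F : Type u} [Field F] [LinearOrder F] [IsStrictOrderedRing F]

/-- The point `a + t (b - a)`. -/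
def along (a b : F × F) (t : F) : F × F := (a.1 + t * (b.1 - a.1), a.2 + t * (b.2 - a.2))

/-- The squared distance. -/
def distSq (a b : F × F) : F := dot (b - a) (b - a)

/-- Both coordinates lie in `R`. -/
def CoordMem (R : Subring F) (a : F × F) : Prop := a.1 ∈ R ∧ a.2 ∈ R

/-- Strict betweenness, with positivity understood in the convex subring `R`. -/
def Betw (R : Subring F) (a b c : F × F) : Prop :=
  cross (c - b) (b - a) = 0 ∧ UnitPos R (dot (b - c) (a - b))

/-- Nonstrict betweenness in the plane over `F`. -/
def WeakBetw (a b c : F × F) : Prop := a = b ∨ Betw ⊤ a b c ∨ b = c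

section

variable {R : Subring F} {a b c d x y : F × F} {r s t : F}

theorem CoordMem.sub (ha : CoordMem R a) (hb : CoordMem R b) : CoordMem R (a - b) :=
  ⟨R.sub_mem ha.1 hb.1, R.sub_mem ha.2 hb.2⟩

theorem CoordMem.dot (ha : CoordMem R a) (hb : CoordMem R b) : dot a b ∈ R :=
  R.add_mem (R.mul_mem ha.1 hb.1) (R.mul_mem ha.2 hb.2)

theorem CoordMem.cross (ha : CoordMem R a) (hb : CoordMem R b) : cross a b ∈ R :=
  R.sub_mem (R.mul_mem ha.1 hb.2) (R.mul_mem ha.2 hb.1)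

theorem CoordMem.distSq (ha : CoordMem R a) (hb : CoordMem R b) : distSq a b ∈ R :=
  (hb.sub ha).dot (hb.sub ha)

theorem CoordMem.along (ha : CoordMem R a) (hb : CoordMem R b) (ht : t ∈ R) :
    CoordMem R (along a b t) :=
  ⟨R.add_mem ha.1 (R.mul_mem ht (R.sub_mem hb.1 ha.1)),
    R.add_mem ha.2 (R.mul_mem ht (R.sub_mem hb.2 ha.2))⟩

theorem dot_self_nonneg (a : F × F) : 0 ≤ dot a a :=
  add_nonneg (mul_self_nonneg _) (mul_self_nonneg _)

theorem dot_self_eq_zero : dot a a = 0 ↔ a = 0 := by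
  constructor
  · intro h
    have h₁ : a.1 * a.1 + a.2 * a.2 = 0 := h
    obtain ⟨h₁, h₂⟩ := (add_eq_zero_iff_of_nonneg (mul_self_nonneg _) (mul_self_nonneg _)).1 h₁
    exact Prod.ext (mul_self_eq_zero.1 h₁) (mul_self_eq_zero.1 h₂)
  · rintro rfl
    simp [dot]

theorem distSq_nonneg (a b : F × F) : 0 ≤ distSq a b := dot_self_nonneg _

theorem distSq_eq_zero : distSq a b = 0 ↔ a = b := by
  rw [distSq, dot_self_eq_zero, sub_eq_zero, eq_comm]

theorem distSq_comm (a b : F × F) : distSq a b = distSq b a := by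
  simp only [distSq, dot, Prod.fst_sub, Prod.snd_sub]
  ring

/-- Lagrange's identity. It turns information on dot and cross products into information on the
lengths. -/
theorem dot_sq_add_cross_sq (a b : F × F) :
    dot a b ^ 2 + cross a b ^ 2 = dot a a * dot b b := by
  simp only [dot, cross]
  ring

theorem along_zero : along a b 0 = a := by simp [along]

theorem along_one : along a b 1 = b := by simp [along]

theorem distSq_along_along :
    distSq (along a b s) (along a b t) = (t - s) * (t - s) * distSq a b := by
  simp only [distSq, dot, along, Prod.fst_sub, Prod.snd_sub]
  ring

theorem distSq_along : distSq a (along a b t) = t * t * distSq a b := by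
  simp only [distSq, dot, along, Prod.fst_sub, Prod.snd_sub]
  ring

theorem betw_along (h : UnitPos R (distSq a b)) (hrs : UnitPos R (s - r)) (hst : UnitPos R (t - s)) :
    Betw R (along a b r) (along a b s) (along a b t) := by
  refine ⟨?_, ?_⟩
  · simp only [cross, along, Prod.fst_sub, Prod.snd_sub]
    ring
  · convert (hrs.mul hst).mul h using 1
    simp only [distSq, dot, along, Prod.fst_sub, Prod.snd_sub]
    ring

theorem betw_along_one (h : UnitPos R (distSq a b)) (ht : UnitPos R t) :
    Betw R a b (along a b (1 + t)) := by
  have := betw_along (r := 0) (s := 1) (t := 1 + t) h (by simpa using UnitPos.one) (by simpa using ht)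
  rwa [along_zero, along_one] at this

theorem betw_along_mid (h : UnitPos R (distSq a b)) (ht : UnitPos R t) (ht' : UnitPos R (1 - t)) :
    Betw R a (along a b t) b := by
  have := betw_along (r := 0) (s := t) (t := 1) h (by simpa using ht) ht'
  rwa [along_zero, along_one] at this

theorem Betw.symm (h : Betw R a b c) : Betw R c b a := by
  obtain ⟨h₁, h₂⟩ := h
  refine ⟨?_, ?_⟩
  · simp only [cross, Prod.fst_sub, Prod.snd_sub] at h₁ ⊢
    linear_combination -h₁
  · convert h₂ using 1
    simp only [dot, Prod.fst_sub, Prod.snd_sub]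
    ring

/-- The cross product vanishes, so by Lagrange's identity the product of the two squared lengths is
the square of the appreciable dot product. Hence `distSq a b` is appreciable and may be divided by;
the parameter is the dot product over it. -/
theorem Betw.exists_along (ha : CoordMem R a) (hb : CoordMem R b) (hc : CoordMem R c)
    (h : Betw R a b c) : UnitPos R (distSq a b) ∧ ∃ t, UnitPos R t ∧ c = along a b (1 + t) := by
  obtain ⟨h₁, h₂⟩ := h
  have hD := dot_sq_add_cross_sq (c - b) (b - a)
  have hdot : dot (c - b) (b - a) = dot (b - c) (a - b) := by
    simp only [dot, Prod.fst_sub, Prod.snd_sub]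
    ring
  rw [h₁, hdot] at hD
  have hprod : UnitPos R (distSq b c * distSq a b) := by
    convert h₂.mul h₂ using 1
    simp only [distSq]
    linear_combination -hD
  have hbc : 0 < distSq b c :=
    (distSq_nonneg b c).lt_of_ne fun h => by
      have := hprod.1
      simp [← h] at this
  have hab : UnitPos R (distSq a b) := UnitPos.of_mul hbc (hb.distSq hc) (ha.distSq hb) hprod
  refine ⟨hab, _, h₂.div hab, ?_⟩
  have hne := hab.1.ne'
  have e₁ : distSq a b * (c.1 - b.1) = dot (b - c) (a - b) * (b.1 - a.1) := by
    simp only [cross, distSq, dot, Prod.fst_sub, Prod.snd_sub] at h₁ ⊢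
    linear_combination (b.2 - a.2) * h₁
  have e₂ : distSq a b * (c.2 - b.2) = dot (b - c) (a - b) * (b.2 - a.2) := by
    simp only [cross, distSq, dot, Prod.fst_sub, Prod.snd_sub] at h₁ ⊢
    linear_combination (a.1 - b.1) * h₁
  refine Prod.ext ?_ ?_ <;> simp only [along] <;> field_simp
  · linear_combination e₁
  · linear_combination e₂

theorem Betw.exists_mid (hR : IsConvexSubring R) (ha : CoordMem R a) (hb : CoordMem R b)
    (hc : CoordMem R c) (h : Betw R a b c) :
    UnitPos R (distSq a c) ∧ ∃ t, UnitPos R t ∧ UnitPos R (1 - t) ∧ b = along a c t := by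
  obtain ⟨hab, t, ht, rfl⟩ := h.exists_along ha hb hc
  have ht1 : UnitPos R (1 + t) := UnitPos.one.add hR ht
  have hne := ht1.1.ne'
  refine ⟨?_, (1 + t)⁻¹, ht1.inv, ?_, ?_⟩
  · rw [distSq_along]
    exact (ht1.mul ht1).mul hab
  · convert ht.div ht1 using 1
    field_simp
    ring
  · refine Prod.ext ?_ ?_ <;> simp only [along] <;> field_simp <;> ring

theorem Betw.distSq_right (hb : CoordMem R b) (hc : CoordMem R c) (ha : CoordMem R a)
    (h : Betw R a b c) : UnitPos R (distSq b c) := by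
  rw [distSq_comm]
  exact (h.symm.exists_along hc hb ha).1

/-- The points on the ray from `a` through `b`. -/
theorem exists_along_of_betw_betw (hd : CoordMem R d) (ha : CoordMem R a) (hb : CoordMem R b)
    (hx : CoordMem R x) (h₁ : Betw R d a b) (h₂ : Betw R d a x) :
    ∃ t, UnitPos R t ∧ x = along a b t := by
  obtain ⟨-, t, ht, rfl⟩ := h₁.exists_along hd ha hb
  obtain ⟨-, s, hs, rfl⟩ := h₂.exists_along hd ha hx
  refine ⟨_, hs.div ht, ?_⟩
  have := ht.1.ne'
  refine Prod.ext ?_ ?_ <;> simp only [along] <;> field_simp <;> ring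

/-- The relation `a # b`. -/
theorem exists_betw_iff (hR : IsConvexSubring R) (ha : CoordMem R a) (hb : CoordMem R b) :
    (∃ c, CoordMem R c ∧ (Betw R c a b ∨ Betw R a c b ∨ Betw R a b c)) ↔
      UnitPos R (distSq a b) := by
  constructor
  · rintro ⟨c, hc, h | h | h⟩
    · exact h.distSq_right ha hb hc
    · exact (h.exists_mid hR ha hc hb).1
    · exact (h.exists_along ha hb hc).1
  · intro h
    -- The witness is the reflection of `a` in `b`.
    exact ⟨along a b (1 + 1), ha.along hb (R.add_mem R.one_mem R.one_mem),
      .inr (.inr (betw_along_one h UnitPos.one))⟩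

theorem betw_top_iff : Betw ⊤ a b c ↔ cross (c - b) (b - a) = 0 ∧ 0 < dot (b - c) (a - b) := by
  rw [Betw, unitPos_top]

theorem Betw.top (h : Betw R a b c) : Betw ⊤ a b c := betw_top_iff.2 ⟨h.1, h.2.1⟩

/-- In the boundary case both products vanish, and Lagrange's identity makes one of the two segments
a point. -/
theorem weakBetw_iff :
    WeakBetw a b c ↔ cross (c - b) (b - a) = 0 ∧ 0 ≤ dot (b - c) (a - b) := by
  rw [WeakBetw, betw_top_iff]
  constructor
  · rintro (rfl | h | rfl)
    · simp [cross, dot]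
    · exact ⟨h.1, h.2.le⟩
    · simp [cross, dot]
  · rintro ⟨h₁, h₂⟩
    rcases h₂.lt_or_eq with h₂ | h₂
    · exact .inr (.inl ⟨h₁, h₂⟩)
    · have hD := dot_sq_add_cross_sq (c - b) (b - a)
      have hdot : dot (c - b) (b - a) = dot (b - c) (a - b) := by
        simp only [dot, Prod.fst_sub, Prod.snd_sub]
        ring
      rw [h₁, hdot, ← h₂] at hD
      have : distSq b c * distSq a b = 0 := by
        simp only [distSq]
        linear_combination -hD
      rcases mul_eq_zero.1 this with h | h
      · exact .inr (.inr (distSq_eq_zero.1 h))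
      · exact .inl (distSq_eq_zero.1 h)

theorem coordMem_top (a : F × F) : CoordMem ⊤ a := ⟨trivial, trivial⟩

theorem WeakBetw.exists_along (hab : a ≠ b) (h : WeakBetw a b c) :
    ∃ t, 0 ≤ t ∧ c = along a b (1 + t) := by
  rcases h with h | h | rfl
  · exact absurd h hab
  · obtain ⟨-, t, ht, rfl⟩ := h.exists_along (coordMem_top _) (coordMem_top _) (coordMem_top _)
    exact ⟨t, ht.1.le, rfl⟩
  · exact ⟨0, le_rfl, by rw [add_zero, along_one]⟩

theorem ne_of_unitPos_distSq (h : UnitPos R (distSq a b)) : a ≠ b :=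
  fun hab => h.1.ne' (distSq_eq_zero.2 hab)

/-- A point of the line `a b` is in one of the five positions. -/
theorem collinear_along (hab : a ≠ b) (t : F) :
    Betw ⊤ (along a b t) a b ∨ along a b t = a ∨ Betw ⊤ a (along a b t) b ∨ along a b t = b ∨
      Betw ⊤ a b (along a b t) := by
  have h : UnitPos ⊤ (distSq a b) :=
    unitPos_top.2 ((distSq_nonneg a b).lt_of_ne fun h => hab (distSq_eq_zero.1 h.symm))
  rcases lt_trichotomy t 0 with ht | rfl | ht
  · left
    have := betw_along (r := t) (s := 0) (t := 1) h (unitPos_top.2 (by linarith))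
      (unitPos_top.2 (by linarith))
    rwa [along_zero, along_one] at this
  · exact .inr (.inl along_zero)
  rcases lt_trichotomy t 1 with ht' | rfl | ht'
  · exact .inr (.inr (.inl (betw_along_mid h (unitPos_top.2 ht) (unitPos_top.2 (by linarith)))))
  · exact .inr (.inr (.inr (.inl along_one)))
  · refine .inr (.inr (.inr (.inr ?_)))
    have := betw_along_one h (unitPos_top.2 (sub_pos.2 ht'))
    rwa [add_sub_cancel] at this

end

end Plane

section Plane

variable {F : Type u} [Field F] [LinearOrder F] [IsStrictOrderedRing F]
  {R : Subring F} {a b c d e p q u v w x y : F × F} {r s t : F}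

/-! ### Betweenness -/

theorem not_betw_self : ¬ Betw R a b a := by
  rintro ⟨-, h⟩
  have h₁ := distSq_nonneg a b
  have h₂ : dot (b - a) (a - b) = - distSq a b := by
    simp only [distSq, dot, Prod.fst_sub, Prod.snd_sub]
    ring
  have := h.1
  linarith

theorem Betw.inner_trans (hR : IsConvexSubring R) (ha : CoordMem R a) (hb : CoordMem R b)
    (hc : CoordMem R c) (hd : CoordMem R d) (h₁ : Betw R a b d) (h₂ : Betw R b c d) :
    Betw R a b c := by
  obtain ⟨hab, s, hs, rfl⟩ := h₁.exists_along ha hb hd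
  obtain ⟨-, t, ht, ht', rfl⟩ := h₂.exists_mid hR hb hc hd
  convert betw_along_one hab (ht.mul hs) using 1
  refine Prod.ext ?_ ?_ <;> simp only [along] <;> ring

/-- Trichotomy for the parameters of `b` and `c` on the segment `a d`. It is stated over `⊤` since
the negated hypotheses of the axiom are evaluated at the upper node. -/
theorem Betw.connectivity (h₁ : Betw ⊤ a b d) (h₂ : Betw ⊤ a c d) (h₃ : ¬ Betw ⊤ a b c)
    (h₄ : ¬ Betw ⊤ a c b) : b = c := by
  obtain ⟨had, s, hs, -, rfl⟩ := h₁.exists_mid isConvexSubring_top (coordMem_top _)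
    (coordMem_top _) (coordMem_top _)
  obtain ⟨-, t, ht, -, rfl⟩ := h₂.exists_mid isConvexSubring_top (coordMem_top _)
    (coordMem_top _) (coordMem_top _)
  have key : ∀ s t : F, 0 < s → s < t → Betw ⊤ a (along a d s) (along a d t) := by
    intro s t hs hst
    have := betw_along (r := 0) (s := s) (t := t) had (unitPos_top.2 (by linarith))
      (unitPos_top.2 (by linarith))
    rwa [along_zero] at this
  rcases lt_trichotomy s t with h | rfl | h
  · exact absurd (key _ _ hs.1 h) h₃
  · rfl
  · exact absurd (key _ _ ht.1 h) h₄

/-! ### Square roots -/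

theorem exists_nonneg_sqrt (hF : ∀ x : F, 0 ≤ x → ∃ z : F, z * z = x) {x : F} (hx : 0 ≤ x) :
    ∃ z : F, 0 ≤ z ∧ z * z = x := by
  obtain ⟨z, hz⟩ := hF x hx
  exact ⟨|z|, abs_nonneg z, by rw [abs_mul_abs_self, hz]⟩

/-- The parameter `t` is the ratio of the lengths `cd` and `ab`: a square root in `F`, brought back
into `R` by convexity. -/
theorem exists_extension (hF : ∀ x : F, 0 ≤ x → ∃ z : F, z * z = x) (hR : IsConvexSubring R)
    (ha : CoordMem R a) (hb : CoordMem R b) (hc : CoordMem R c) (hd : CoordMem R d)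
    (hab : UnitPos R (distSq a b)) :
    ∃ t, 0 ≤ t ∧ t ∈ R ∧ t * t = distSq c d / distSq a b ∧
      CoordMem R (along a b (1 + t)) ∧ distSq b (along a b (1 + t)) = distSq c d := by
  obtain ⟨t, ht, htt⟩ := exists_nonneg_sqrt hF (div_nonneg (distSq_nonneg c d) hab.1.le)
  have htR : t ∈ R := hR.mem_of_mul_self_mem (htt ▸ UnitPos.div_mem (hc.distSq hd) hab)
  refine ⟨t, ht, htR, htt, ha.along hb (R.add_mem R.one_mem htR), ?_⟩
  have := distSq_along_along (a := a) (b := b) (s := 1) (t := 1 + t)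
  rw [along_one, add_sub_cancel_left, htt, div_mul_cancel₀ _ hab.1.ne'] at this
  exact this

theorem exists_weakBetw_distSq (hF : ∀ x : F, 0 ≤ x → ∃ z : F, z * z = x) (hR : IsConvexSubring R)
    (ha : CoordMem R a) (hb : CoordMem R b) (hc : CoordMem R c) (hd : CoordMem R d)
    (hab : UnitPos R (distSq a b)) :
    ∃ e, CoordMem R e ∧ WeakBetw a b e ∧ distSq b e = distSq c d := by
  obtain ⟨t, ht, -, -, he, heq⟩ := exists_extension hF hR ha hb hc hd hab
  refine ⟨_, he, ?_, heq⟩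
  rcases ht.eq_or_lt with rfl | ht
  · exact .inr (.inr (by rw [add_zero, along_one]))
  · exact .inr (.inl (betw_along_one (unitPos_top.2 hab.1) (unitPos_top.2 ht)))

theorem exists_betw_distSq (hF : ∀ x : F, 0 ≤ x → ∃ z : F, z * z = x) (hR : IsConvexSubring R)
    (ha : CoordMem R a) (hb : CoordMem R b) (hc : CoordMem R c) (hd : CoordMem R d)
    (hab : UnitPos R (distSq a b)) (hcd : UnitPos R (distSq c d)) :
    ∃ e, CoordMem R e ∧ Betw R a b e ∧ distSq b e = distSq c d := by
  obtain ⟨t, ht, -, htt, he, heq⟩ := exists_extension hF hR ha hb hc hd hab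
  have htt' : UnitPos R (t * t) := htt ▸ hcd.div hab
  have ht0 : 0 < t := ht.lt_of_ne fun h => by
    have := htt'.1
    simp [← h] at this
  exact ⟨_, he, betw_along_one hab (UnitPos.of_mul_self hR ht0 htt'), heq⟩

/-- Stewart's theorem. In `five_segments` it determines `cd` from `ab`, `ad`, `bd` and the common
ratio of `bc` to `ab`. -/
theorem distSq_along_right :
    distSq (along a b (1 + t)) d =
      (1 + t) * distSq b d - t * distSq a d + t * (1 + t) * distSq a b := by
  simp only [distSq, dot, along, Prod.fst_sub, Prod.snd_sub]
  ring

theorem five_segments {a' b' c' d' : F × F} (hab : a ≠ b) (h : WeakBetw a b c)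
    (h' : WeakBetw a' b' c') (eab : distSq a b = distSq a' b') (ebc : distSq b c = distSq b' c')
    (ead : distSq a d = distSq a' d') (ebd : distSq b d = distSq b' d') :
    distSq c d = distSq c' d' := by
  have hab' : a' ≠ b' := fun h => hab (distSq_eq_zero.1 (eab.trans (distSq_eq_zero.2 h)))
  obtain ⟨s, hs, rfl⟩ := h.exists_along hab
  obtain ⟨t, ht, rfl⟩ := h'.exists_along hab'
  have h₁ := distSq_along_along (a := a) (b := b) (s := 1) (t := 1 + s)
  have h₂ := distSq_along_along (a := a') (b := b') (s := 1) (t := 1 + t)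
  rw [along_one, add_sub_cancel_left] at h₁ h₂
  rw [h₁, h₂, ← eab] at ebc
  have hne : distSq a b ≠ 0 := fun h => hab (distSq_eq_zero.1 h)
  have hst : s = t := (mul_self_inj hs ht).1 (mul_right_cancel₀ hne ebc)
  rw [distSq_along_right, distSq_along_right, eab, ead, ebd, hst]

/-! ### Angles and the Pasch laws -/

/-- By Lagrange's identity the product of the squared sides is at least the squared cross product,
hence appreciable, and so is its factor `distSq b a`. -/
theorem UnitPos.distSq_of_cross (hR : IsConvexSubring R) (ha : CoordMem R a) (hb : CoordMem R b)
    (hc : CoordMem R c) (h : UnitPos R (cross (a - b) (c - b) ^ 2)) : UnitPos R (distSq b a) := by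
  have hD := dot_sq_add_cross_sq (a - b) (c - b)
  have hm : UnitPos R (distSq b c * distSq b a) := by
    convert h.add_nonneg hR (sq_nonneg (dot (a - b) (c - b)))
      (R.pow_mem ((ha.sub hb).dot (hc.sub hb)) 2) using 1
    simp only [distSq]
    linear_combination -hD
  have hbc : 0 < distSq b c :=
    (distSq_nonneg b c).lt_of_ne fun h => by
      have := hm.1
      simp [← h] at this
  exact UnitPos.of_mul hbc (hb.distSq hc) (hb.distSq ha) hm

/-- With `c` as origin, `p` and `q` sit at parameters `s` and `t` on `c a` and `c b`, and the
intersection is found by solving a linear system. Its denominator `1 - s * t = (1 - s) + s * (1 -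
t)` is always appreciable; the angle condition only serves to make the segments `p b` and `a q`
appreciable. -/
theorem inner_pasch (hR : IsConvexSubring R) (ha : CoordMem R a) (hb : CoordMem R b)
    (hc : CoordMem R c) (hp : CoordMem R p) (hq : CoordMem R q) (h₁ : Betw R a p c)
    (h₂ : Betw R b q c)
    (h : UnitPos R (cross (a - c) (b - c) ^ 2) ∨ UnitPos R (cross (q - p) (a - p) ^ 2)) :
    ∃ x, CoordMem R x ∧ Betw R p x b ∧ Betw R a x q := by
  obtain ⟨-, s, hs, hs', rfl⟩ := h₁.symm.exists_mid hR hc hp ha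
  obtain ⟨-, t, ht, ht', rfl⟩ := h₂.symm.exists_mid hR hc hq hb
  have hX : UnitPos R (cross (a - c) (b - c) ^ 2) := by
    rcases h with h | h
    · exact h
    -- The cross product at `p` is, up to sign, `t * (1 - s)` times the one at `c`.
    · refine UnitPos.of_mul (x := (t * (1 - s)) ^ 2) (pow_pos (mul_pos ht.1 hs'.1) 2)
        (R.pow_mem (ht.mul hs').2.1 2) (R.pow_mem ((ha.sub hc).cross (hb.sub hc)) 2) ?_
      convert h using 1
      simp only [cross, along, Prod.fst_sub, Prod.snd_sub]
      ring
  have hst : UnitPos R (1 - s * t) := by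
    convert hs'.add hR (hs.mul ht') using 1
    ring
  have hne := hst.1.ne'
  have hpb : UnitPos R (distSq (along c a s) b) := by
    rw [distSq_comm]
    refine UnitPos.distSq_of_cross hR hp hb hc ?_
    convert (hs.mul hs).mul hX using 1
    simp only [cross, along, Prod.fst_sub, Prod.snd_sub]
    ring
  have haq : UnitPos R (distSq a (along c b t)) := by
    refine UnitPos.distSq_of_cross hR hq ha hc ?_
    convert (ht.mul ht).mul hX using 1
    simp only [cross, along, Prod.fst_sub, Prod.snd_sub]
    ring
  have hα : UnitPos R (t * (1 - s) / (1 - s * t)) := (ht.mul hs').div hst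
  have hα' : UnitPos R (1 - t * (1 - s) / (1 - s * t)) := by
    convert ht'.div hst using 1
    rw [eq_div_iff hne, sub_mul, div_mul_cancel₀ _ hne]
    ring
  have hβ : UnitPos R ((1 - s) / (1 - s * t)) := hs'.div hst
  have hβ' : UnitPos R (1 - (1 - s) / (1 - s * t)) := by
    convert (hs.mul ht').div hst using 1
    field_simp
    ring
  refine ⟨_, hp.along hb hα.2.1, betw_along_mid hpb hα hα', ?_⟩
  convert betw_along_mid haq hβ hβ' using 1
  refine Prod.ext ?_ ?_ <;> simp only [along] <;> field_simp <;> ring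

/-- As for `inner_pasch`, now with denominator `1 - s * (1 - t) = (1 - s) + s * t`. Both angle
conditions concern the area of the triangle `a b q`. -/
theorem outer_pasch (hR : IsConvexSubring R) (ha : CoordMem R a) (hb : CoordMem R b)
    (hc : CoordMem R c) (hp : CoordMem R p) (hq : CoordMem R q) (h₁ : Betw R a p c)
    (h₂ : Betw R b c q)
    (h : UnitPos R (cross (b - a) (q - a) ^ 2) ∨ UnitPos R (cross (a - b) (q - b) ^ 2)) :
    ∃ x, CoordMem R x ∧ Betw R b p x ∧ Betw R a x q := by
  obtain ⟨-, s, hs, hs', rfl⟩ := h₁.exists_mid hR ha hp hc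
  obtain ⟨-, t, ht, ht', rfl⟩ := h₂.exists_mid hR hb hc hq
  have hX : UnitPos R (cross (a - b) (q - b) ^ 2) := by
    rcases h with h | h
    · convert h using 1
      simp only [cross, Prod.fst_sub, Prod.snd_sub]
      ring
    · exact h
  have hst : UnitPos R (1 - s * (1 - t)) := by
    convert hs'.add hR (hs.mul ht) using 1
    ring
  have hne := hst.1.ne'
  have hbp : UnitPos R (distSq b (along a (along b q t) s)) := by
    refine UnitPos.distSq_of_cross hR hp hb hq ?_
    convert (hs'.mul hs').mul hX using 1
    simp only [cross, along, Prod.fst_sub, Prod.snd_sub]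
    ring
  have haq : UnitPos R (distSq a q) := by
    refine UnitPos.distSq_of_cross hR hq ha hb ?_
    convert hX using 1
    simp only [cross, Prod.fst_sub, Prod.snd_sub]
    ring
  have hδ : UnitPos R (s * (1 - t) / (1 - s * (1 - t))) := (hs.mul ht').div hst
  have hγ : UnitPos R (s * t / (1 - s * (1 - t))) := (hs.mul ht).div hst
  have hγ' : UnitPos R (1 - s * t / (1 - s * (1 - t))) := by
    convert hs'.div hst using 1
    field_simp
    ring
  refine ⟨_, ha.along hq hγ.2.1, ?_, betw_along_mid haq hγ hγ'⟩
  convert betw_along_one hbp hδ using 1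
  refine Prod.ext ?_ ?_ <;> simp only [along] <;> field_simp <;> ring

/-- The directions from `b` to `a` and to `c` differ appreciably. -/
def DirApart (R : Subring F) (a b c : F × F) : Prop :=
  ∀ r s : F, 0 ≤ r → 0 ≤ s → r * r = distSq b a → s * s = distSq b c →
    UnitPos R (r * s - dot (a - b) (c - b))

theorem mul_sub_dot_mem (hR : IsConvexSubring R) (ha : CoordMem R a) (hb : CoordMem R b)
    (hc : CoordMem R c) (hr : r * r = distSq b a) (hs : s * s = distSq b c) :
    r * s - dot (a - b) (c - b) ∈ R :=
  R.sub_mem (R.mul_mem (hR.mem_of_mul_self_mem (hr ▸ hb.distSq ha))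
    (hR.mem_of_mul_self_mem (hs ▸ hb.distSq hc))) ((ha.sub hb).dot (hc.sub hb))

/-- If `p`, `q` are the lengths of `ba`, `bc`, the isosceles condition says `s * p = t * q`. The law
of cosines then gives the squared base as `2 * (s * t)` times `p * q - dot (a - b) (c - b)`. -/
theorem dirApart_of_isosceles (hR : IsConvexSubring R) (ha : CoordMem R a) (hb : CoordMem R b)
    (hc : CoordMem R c) (hs : UnitPos R s) (ht : UnitPos R t)
    (heq : distSq b (along b a s) = distSq b (along b c t))
    (h : UnitPos R (distSq (along b a s) (along b c t))) : DirApart R a b c := by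
  intro p q hp hq hpp hqq
  rw [distSq_along, distSq_along, ← hpp, ← hqq] at heq
  have hpq : s * p = t * q :=
    (mul_self_inj (mul_nonneg hs.1.le hp) (mul_nonneg ht.1.le hq)).1 (by linear_combination heq)
  have h2 : UnitPos R (2 : F) := by exact_mod_cast UnitPos.natCast hR (n := 2) (by norm_num)
  have hst := h2.mul (hs.mul ht)
  refine UnitPos.of_mul hst.1 hst.2.1 (mul_sub_dot_mem hR ha hb hc hpp hqq) ?_
  convert h using 1
  have e : distSq (along b a s) (along b c t) =
      s * s * distSq b a + t * t * distSq b c - 2 * (s * t) * dot (a - b) (c - b) := by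
    simp only [distSq, dot, along, Prod.fst_sub, Prod.snd_sub]
    ring
  rw [e, ← hpp, ← hqq]
  linear_combination -(s * p - t * q) * hpq

/-- This is `(1 - cos θ)(1 + cos θ) = sin² θ`, scaled by the lengths. The first factor measures
distance from the angle `0`, the second from `π`. -/
theorem mul_sub_mul_mul_add_eq_cross_sq (hr : r * r = distSq b a) (hs : s * s = distSq b c) :
    (r * s - dot (a - b) (c - b)) * (r * s + dot (a - b) (c - b)) =
      cross (a - b) (c - b) ^ 2 := by
  have hD := dot_sq_add_cross_sq (a - b) (c - b)
  simp only [distSq] at hr hs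
  linear_combination -hD + (s * s) * hr + dot (a - b) (a - b) * hs

theorem abs_dot_le (hr : 0 ≤ r) (hs : 0 ≤ s) (hrr : r * r = distSq b a)
    (hss : s * s = distSq b c) : |dot (a - b) (c - b)| ≤ r * s := by
  refine abs_le_of_sq_le_sq ?_ (mul_nonneg hr hs)
  have := mul_sub_mul_mul_add_eq_cross_sq hrr hss
  nlinarith [sq_nonneg (cross (a - b) (c - b))]

theorem dirApart_of_cross (hR : IsConvexSubring R) (ha : CoordMem R a) (hb : CoordMem R b)
    (hc : CoordMem R c) (h : UnitPos R (cross (a - b) (c - b) ^ 2)) : DirApart R a b c := by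
  intro p q hp hq hpp hqq
  have hab := abs_le.1 (abs_dot_le hp hq hpp hqq)
  have e := mul_sub_mul_mul_add_eq_cross_sq hpp hqq
  rw [← e, mul_comm] at h
  have hpos : 0 < p * q + dot (a - b) (c - b) := by
    refine lt_of_le_of_ne (by linarith [hab.1]) fun h0 => ?_
    have := h.1
    simp [← h0] at this
  refine UnitPos.of_mul hpos (R.add_mem ?_ ((ha.sub hb).dot (hc.sub hb)))
    (mul_sub_dot_mem hR ha hb hc hpp hqq) h
  exact R.mul_mem (hR.mem_of_mul_self_mem (hpp ▸ hb.distSq ha))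
    (hR.mem_of_mul_self_mem (hqq ▸ hb.distSq hc))

/-- The relation `R(a,b,c)`: a right angle at `b`. -/
theorem cross_of_right_angle (ha : CoordMem R a) (hb : CoordMem R b)
    (hd : CoordMem R d) (h₁ : Betw R a b d) (h₂ : distSq a b = distSq b d)
    (h₃ : distSq a c = distSq d c) (hcb : UnitPos R (distSq c b)) :
    UnitPos R (cross (a - b) (c - b) ^ 2) := by
  obtain ⟨hab, t, ht, rfl⟩ := h₁.exists_along ha hb hd
  have e := distSq_along_along (a := a) (b := b) (s := 1) (t := 1 + t)
  rw [along_one, add_sub_cancel_left, ← h₂] at e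
  have ht1 : t = 1 := by
    have : t * t = 1 * 1 := mul_right_cancel₀ hab.1.ne' (by linear_combination -e)
    exact (mul_self_inj ht.1.le zero_le_one).1 this
  subst ht1
  rw [distSq_along_right] at h₃
  -- As `d` is the reflection of `a` in `b`, the equality `ac = dc` is perpendicularity at `b`. The
  -- squared cross product is then the product of the squared sides.
  have hdot : dot (a - b) (c - b) = 0 := by
    have : (4 : F) * dot (a - b) (c - b) = 0 := by
      simp only [distSq, dot, Prod.fst_sub, Prod.snd_sub] at h₃ ⊢
      linear_combination -h₃
    simpa using this
  have hD := dot_sq_add_cross_sq (a - b) (c - b)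
  convert hab.mul hcb using 1
  rw [hdot] at hD
  simp only [distSq, dot, Prod.fst_sub, Prod.snd_sub] at hD ⊢
  linear_combination hD

/-- Heron's formula expresses the squared cross product through the squared sides. -/
theorem cross_sq_of_congruent {a' b' c' : F × F} (h₁ : distSq b a = distSq b' a')
    (h₂ : distSq b c = distSq b' c') (h₃ : distSq a c = distSq a' c') :
    cross (a - b) (c - b) ^ 2 = cross (a' - b') (c' - b') ^ 2 := by
  have key : ∀ a b c : F × F, 4 * cross (a - b) (c - b) ^ 2 =
      4 * distSq b a * distSq b c - (distSq b a + distSq b c - distSq a c) ^ 2 := by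
    intro a b c
    simp only [cross, distSq, dot, Prod.fst_sub, Prod.snd_sub]
    ring
  have : (4 : F) * cross (a - b) (c - b) ^ 2 = 4 * cross (a' - b') (c' - b') ^ 2 := by
    rw [key, key, h₁, h₂, h₃]
  exact mul_left_cancel₀ (by norm_num) this

theorem cross_along : cross (along b a s - b) (along b c t - b) =
    s * t * cross (a - b) (c - b) := by
  simp only [cross, along, Prod.fst_sub, Prod.snd_sub]
  ring

/-- `∠abc = ∠a'b'c'`, with `s, t, s', t'` giving the points on the rays. -/
theorem UnitPos.cross_of_angle_congruent {a' b' c' : F × F} {s' t' : F}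
    (ha : CoordMem R a) (hb : CoordMem R b) (hc : CoordMem R c)
    (hs : UnitPos R s) (ht : UnitPos R t) (hs' : UnitPos R s') (ht' : UnitPos R t')
    (h₁ : distSq b (along b a s) = distSq b' (along b' a' s'))
    (h₂ : distSq b (along b c t) = distSq b' (along b' c' t'))
    (h₃ : distSq (along b a s) (along b c t) = distSq (along b' a' s') (along b' c' t'))
    (h : UnitPos R (cross (a' - b') (c' - b') ^ 2)) : UnitPos R (cross (a - b) (c - b) ^ 2) := by
  have e := cross_sq_of_congruent h₁ h₂ h₃
  rw [cross_along, cross_along, mul_pow (s * t), mul_pow (s' * t')] at e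
  have hst := (hs.mul ht).mul (hs.mul ht)
  have hst' := (hs'.mul ht').mul (hs'.mul ht')
  rw [← pow_two] at hst hst'
  exact UnitPos.of_mul hst.1 hst.2.1 (R.pow_mem ((ha.sub hb).cross (hc.sub hb)) 2)
    (e ▸ hst'.mul h)

/-- The angle `abc` is neither infinitesimally small nor infinitesimally close to `π`. -/
theorem cross_of_dirApart (hF : ∀ x : F, 0 ≤ x → ∃ z : F, z * z = x) (ha : CoordMem R a)
    (hb : CoordMem R b) (hd : CoordMem R d) (h₁ : DirApart R a b c)
    (hdba : Betw R d b a) (h₂ : DirApart R d b c) : UnitPos R (cross (a - b) (c - b) ^ 2) := by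
  obtain ⟨-, t, ht, rfl⟩ := hdba.symm.exists_along ha hb hd
  obtain ⟨r, hr, hrr⟩ := exists_nonneg_sqrt hF (distSq_nonneg b a)
  obtain ⟨s, hs, hss⟩ := exists_nonneg_sqrt hF (distSq_nonneg b c)
  have h₁ := h₁ r s hr hs hrr hss
  -- Here `d - b = -t * (a - b)`, so the ray is reversed and `h₂` yields `t * (r * s + dot)`, the
  -- second factor of the squared cross product.
  have h₂ := h₂ (t * r) s (mul_nonneg ht.1.le hr) hs ?_ hss
  · rw [← mul_sub_mul_mul_add_eq_cross_sq hrr hss]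
    refine h₁.mul ?_
    convert h₂.div ht using 1
    have := ht.1.ne'
    field_simp
    simp only [dot, along, Prod.fst_sub, Prod.snd_sub]
    ring
  · have e := distSq_along_along (a := a) (b := b) (s := 1) (t := 1 + t)
    rw [along_one, add_sub_cancel_left, distSq_comm a b, ← hrr] at e
    rw [e]
    ring

end Plane

section Plane

variable {F : Type u} [Field F] [LinearOrder F] [IsStrictOrderedRing F]
  {R : Subring F} {a b c d e p q u v w x y : F × F} {r s t : F}

/-! ### Circles -/

/-- Nonstrict triangle inequality for the distances `r = ab`, `s = bc`, `t = ac`. -/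
theorem triangle_le (hr : 0 ≤ r) (hs : 0 ≤ s) (hrr : r * r = distSq a b) (hss : s * s = distSq b c)
    (htt : t * t = distSq a c) : t ≤ r + s := by
  rw [distSq_comm] at hrr
  have h := (abs_le.1 (abs_dot_le hr hs hrr hss)).1
  have e : distSq a c = distSq b a + distSq b c - 2 * dot (a - b) (c - b) := by
    simp only [distSq, dot, Prod.fst_sub, Prod.snd_sub]
    ring
  refine le_of_sq_le_sq ?_ (add_nonneg hr hs)
  nlinarith

/-- The ends of a diameter are symmetric about the center. -/
theorem eq_reflection (h : WeakBetw u c v) (heq : distSq c u = distSq c v) :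
    v = along u c (1 + 1) := by
  by_cases huc : u = c
  · subst huc
    have : distSq u v = 0 := by rw [← heq, distSq_eq_zero]
    rw [← distSq_eq_zero.1 this]
    simp [along]
  · obtain ⟨t, ht, rfl⟩ := h.exists_along huc
    have e := distSq_along_along (a := u) (b := c) (s := 1) (t := 1 + t)
    rw [along_one, add_sub_cancel_left, ← heq, distSq_comm c u] at e
    have : t * t = 1 * 1 :=
      mul_right_cancel₀ (fun h => huc (distSq_eq_zero.1 h)) (by linear_combination -e)
    rw [(mul_self_inj ht zero_le_one).1 this]

/-- The power of the point `a` with respect to the circle with diameter `u v`. -/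
theorem dot_eq_of_diameter (h : WeakBetw u c v) (heq : distSq c u = distSq c v) :
    dot (a - v) (u - a) = distSq c u - distSq c a := by
  rw [eq_reflection h heq]
  simp only [distSq, dot, along, Prod.fst_sub, Prod.snd_sub]
  ring

theorem distSq_le_of_diameter (ha : WeakBetw u a v) (h : WeakBetw u c v)
    (heq : distSq c u = distSq c v) : distSq c a ≤ distSq c u := by
  have := (weakBetw_iff.1 ha).2
  rw [dot_eq_of_diameter h heq] at this
  linarith

/-- The line `a b` meets the circle with center `c` and squared radius `r`. -/
theorem exists_line_circle (hF : ∀ x : F, 0 ≤ x → ∃ z : F, z * z = x) (hR : IsConvexSubring R)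
    (ha : CoordMem R a) (hb : CoordMem R b) (hc : CoordMem R c) (hr : r ∈ R)
    (hab : UnitPos R (distSq a b)) (hin : distSq c a ≤ r) :
    ∃ s t, CoordMem R (along a b s) ∧ CoordMem R (along a b t) ∧
      distSq c (along a b s) = r ∧ distSq c (along a b t) = r ∧
      cross (along a b t - a) (a - along a b s) = 0 ∧
      dot (a - along a b t) (along a b s - a) = r - distSq c a := by
  set n := distSq a b with hn
  set m := dot (b - a) (a - c) with hm
  set k := r - distSq c a with hk
  have hk0 : 0 ≤ k := sub_nonneg.2 hin
  have hkR : k ∈ R := R.sub_mem hr (hc.distSq ha)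
  have hmR : m ∈ R := (hb.sub ha).dot (ha.sub hc)
  have hne := hab.1.ne'
  -- The intersection parameters solve `n * t² + 2 * m * t - k = 0`; `z` is a root of its quarter
  -- discriminant.
  obtain ⟨z, hz⟩ := hF (m * m + n * k) (add_nonneg (mul_self_nonneg m) (mul_nonneg hab.1.le hk0))
  have hzR : z ∈ R := hR.mem_of_mul_self_mem
    (hz ▸ R.add_mem (R.mul_mem hmR hmR) (R.mul_mem hab.2.1 hkR))
  have key : ∀ t : F, n * t = -m + z ∨ n * t = -m - z → distSq c (along a b t) = r := by
    intro t ht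
    have e : distSq c (along a b t) = distSq c a + 2 * t * m + t * t * n := by
      simp only [hn, hm, distSq, dot, along, Prod.fst_sub, Prod.snd_sub]
      ring
    have : n * (t * t * n + 2 * t * m - k) = 0 := by
      rcases ht with ht | ht
      · linear_combination (n * t + m + z) * ht + hz
      · linear_combination (n * t + m - z) * ht + hz
    have := (mul_eq_zero.1 this).resolve_left hne
    rw [e]
    linear_combination this
  have hsR : (-m - z) / n ∈ R := UnitPos.div_mem (R.sub_mem (R.neg_mem hmR) hzR) hab
  have htR : (-m + z) / n ∈ R := UnitPos.div_mem (R.add_mem (R.neg_mem hmR) hzR) hab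
  refine ⟨(-m - z) / n, (-m + z) / n, ha.along hb hsR, ha.along hb htR,
    key _ (.inr (mul_div_cancel₀ _ hne)), key _ (.inl (mul_div_cancel₀ _ hne)), ?_, ?_⟩
  · simp only [cross, along, Prod.fst_sub, Prod.snd_sub]
    ring
  · have e : ∀ s t : F, dot (a - along a b t) (along a b s - a) = -(s * t * n) := by
      intro s t
      simp only [hn, distSq, dot, along, Prod.fst_sub, Prod.snd_sub]
      ring
    rw [e]
    have : -((-m - z) / n * ((-m + z) / n) * n) = (z * z - m * m) / n := by
      field_simp
      ring
    rw [this, hz, add_sub_cancel_left, mul_div_cancel_left₀ _ hne]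

/-- Two circles with appreciably distinct centers meet if the triangle inequalities hold. -/
theorem exists_circle_circle (hF : ∀ x : F, 0 ≤ x → ∃ z : F, z * z = x) (hR : IsConvexSubring R)
    (ha : CoordMem R a) (hb : CoordMem R b) (hab : UnitPos R (distSq a b)) {d : F}
    (hrR : r * r ∈ R) (hsR : s * s ∈ R) (hd : d * d = distSq a b)
    (h₁ : d ≤ r + s) (h₂ : r ≤ d + s) (h₃ : s ≤ d + r) :
    ∃ e, CoordMem R e ∧ distSq a e = r * r ∧ distSq b e = s * s := by
  have hne := hab.1.ne'
  have h2 : UnitPos R (2 : F) := by exact_mod_cast UnitPos.natCast hR (n := 2) (by norm_num)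
  set n := distSq a b with hn
  -- The common point is `a + ξ (b - a) + η J(b - a)`, with `J` the quarter turn. Subtracting the
  -- circle equations gives `ξ`; Heron's factorization shows that `η²` is nonnegative.
  set ξ := (r * r - s * s + n) / (2 * n) with hξ
  have hξn : 2 * n * ξ = r * r - s * s + n := mul_div_cancel₀ _ (mul_ne_zero two_ne_zero hne)
  have hξR : ξ ∈ R :=
    UnitPos.div_mem (R.add_mem (R.sub_mem hrR hsR) hab.2.1) (h2.mul hab)
  have hnonneg : 0 ≤ r * r / n - ξ * ξ := by
    have h4 : 0 ≤ ((r + s - d) * (d + s - r)) * ((d + r - s) * (r + s + d)) :=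
      mul_nonneg (mul_nonneg (by linarith) (by linarith)) (mul_nonneg (by linarith) (by linarith))
    have e : r * r / n - ξ * ξ =
        ((r + s - d) * (d + s - r)) * ((d + r - s) * (r + s + d)) / (4 * n * n) := by
      rw [hξ, ← hd]
      have : d ≠ 0 := by
        rintro rfl
        exact hne (by rw [← hd, mul_zero])
      field_simp
      ring
    rw [e]
    have := hab.1
    positivity
  obtain ⟨η, hη⟩ := hF _ hnonneg
  have hηR : η ∈ R := hR.mem_of_mul_self_mem
    (hη ▸ R.sub_mem (UnitPos.div_mem hrR hab) (R.mul_mem hξR hξR))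
  have hηn : n * (η * η) = r * r - n * (ξ * ξ) := by
    rw [hη, mul_sub, mul_div_cancel₀ _ hne]
  refine ⟨(a.1 + ξ * (b.1 - a.1) - η * (b.2 - a.2), a.2 + ξ * (b.2 - a.2) + η * (b.1 - a.1)),
    ⟨?_, ?_⟩, ?_, ?_⟩
  · exact R.sub_mem (ha.along hb hξR).1 (R.mul_mem hηR (R.sub_mem hb.2 ha.2))
  · exact R.add_mem (ha.along hb hξR).2 (R.mul_mem hηR (R.sub_mem hb.1 ha.1))
  · have : n * (ξ * ξ + η * η) = r * r := by linear_combination hηn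
    rw [← this, hn]
    simp only [distSq, dot, Prod.fst_sub, Prod.snd_sub]
    ring
  · have : n * ((ξ - 1) * (ξ - 1) + η * η) = s * s := by linear_combination hηn - hξn
    rw [← this, hn]
    simp only [distSq, dot, Prod.fst_sub, Prod.snd_sub]
    ring

/-- Circle-circle continuity for appreciably distinct centers `c`, `d`: the point `a` of the circle
about `c` is inside the circle about `d` through `w`, and the point `b` is outside. -/
theorem circle_circle (hF : ∀ x : F, 0 ≤ x → ∃ z : F, z * z = x) (hR : IsConvexSubring R)
    (hc : CoordMem R c) (hd : CoordMem R d) (ha : CoordMem R a) (hw : CoordMem R w)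
    (hcd : UnitPos R (distSq c d)) (hin : distSq d a ≤ distSq d w) (hb : distSq c b = distSq c a)
    (hout : distSq d w ≤ distSq d b) :
    ∃ e, CoordMem R e ∧ distSq c e = distSq c a ∧ distSq d e = distSq d w := by
  obtain ⟨r, hr, hrr⟩ := exists_nonneg_sqrt hF (distSq_nonneg c a)
  obtain ⟨s, hs, hss⟩ := exists_nonneg_sqrt hF (distSq_nonneg d w)
  obtain ⟨l, hl, hll⟩ := exists_nonneg_sqrt hF (distSq_nonneg c d)
  obtain ⟨i, hi, hii⟩ := exists_nonneg_sqrt hF (distSq_nonneg d a)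
  obtain ⟨j, hj, hjj⟩ := exists_nonneg_sqrt hF (distSq_nonneg d b)
  have his : i ≤ s := by
    rw [← hii, ← hss] at hin
    exact (mul_self_le_mul_self_iff hi hs).2 hin
  have hsj : s ≤ j := by
    rw [← hjj, ← hss] at hout
    exact (mul_self_le_mul_self_iff hs hj).2 hout
  -- These give `l ≤ r + i`, `r ≤ l + i` and `j ≤ l + r`. With `i ≤ s ≤ j` they become the triangle
  -- inequalities for `l`, `r`, `s`.
  have t₁ := triangle_le hr hi hrr (hii.trans (distSq_comm _ _)) hll
  have t₂ := triangle_le hl hi hll hii hrr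
  have t₃ := triangle_le hl hr (hll.trans (distSq_comm _ _)) (hrr.trans hb.symm) hjj
  rw [← hrr, ← hss]
  exact exists_circle_circle hF hR hc hd hcd (hrr ▸ hc.distSq ha) (hss ▸ hd.distSq hw) hll
    (by linarith) (by linarith) (by linarith)

/-- If a circle about `c` has a point `a` inside the circle about `d` through `w`, and a point `b`
appreciably outside, then the centers are appreciably distinct. -/
theorem UnitPos.distSq_of_circles (hF : ∀ x : F, 0 ≤ x → ∃ z : F, z * z = x)
    (hR : IsConvexSubring R)
    (hc : CoordMem R c) (hd : CoordMem R d) (hw : CoordMem R w)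
    (hbR : CoordMem R b) (hin : distSq d a ≤ distSq d w) (hb : distSq c b = distSq c a)
    (hout : Betw R d w b) : UnitPos R (distSq c d) := by
  obtain ⟨hdw, t, ht, rfl⟩ := hout.exists_along hd hw hbR
  obtain ⟨r, hr, hrr⟩ := exists_nonneg_sqrt hF (distSq_nonneg c a)
  obtain ⟨s, hs, hss⟩ := exists_nonneg_sqrt hF (distSq_nonneg d w)
  obtain ⟨l, hl, hll⟩ := exists_nonneg_sqrt hF (distSq_nonneg c d)
  obtain ⟨i, hi, hii⟩ := exists_nonneg_sqrt hF (distSq_nonneg d a)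
  have his : i ≤ s := by
    rw [← hii, ← hss] at hin
    exact (mul_self_le_mul_self_iff hi hs).2 hin
  have hjj : ((1 + t) * s) * ((1 + t) * s) = distSq d (along d w (1 + t)) := by
    rw [distSq_along, ← hss]
    ring
  -- From `(1 + t) * s ≤ l + r`, `r ≤ l + i` and `i ≤ s` it follows that `t * s ≤ 2 * l`, and `t *
  -- s` is appreciable.
  have t₂ := triangle_le hl hi hll hii hrr
  have t₃ := triangle_le hl hr (hll.trans (distSq_comm _ _)) (hrr.trans hb.symm) hjj
  have hs0 : 0 < s := hs.lt_of_ne fun h => by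
    have := hdw.1
    simp [← hss, ← h] at this
  have hsu : UnitPos R s := UnitPos.of_mul_self hR hs0 (hss ▸ hdw)
  have hlR : l ∈ R := hR.mem_of_mul_self_mem (hll ▸ hc.distSq hd)
  have h2l : UnitPos R (2 * l) :=
    (ht.mul hsu).mono hR (by linarith) (R.mul_mem (by exact_mod_cast natCast_mem R 2) hlR)
  have hlu : UnitPos R l :=
    UnitPos.of_mul two_pos (by exact_mod_cast natCast_mem R 2) hlR h2l
  rw [← hll]
  exact hlu.mul hlu

/-! ### The parallel axiom -/

/-- The diagonals `p q` and `s r` have the common midpoint `m`; the point `a` is between `q`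
and `r`. -/
theorem euclid_five (hR : IsConvexSubring R) {p q r s m a : F × F}
    (hq : CoordMem R q) (hr : CoordMem R r) (hs : CoordMem R s)
    (ha : CoordMem R a) (hpa : UnitPos R (distSq p a)) (hsq : UnitPos R (distSq s q))
    (h₁ : distSq p m = distSq q m) (h₂ : WeakBetw p m q) (h₃ : distSq s m = distSq r m)
    (h₄ : WeakBetw s m r) (h₅ : Betw R q a r) :
    ∃ e, CoordMem R e ∧ Betw R p a e ∧ Betw R s q e := by
  obtain ⟨-, t, ht, ht', rfl⟩ := h₅.exists_mid hR hq ha hr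
  have e₁ := eq_reflection h₂ (by rw [distSq_comm m p, h₁, distSq_comm])
  have e₂ := eq_reflection h₄ (by rw [distSq_comm m s, h₃, distSq_comm])
  -- The common midpoint gives `r - p = q - s`, so the triangles `a r p` and `a q e` are similar
  -- with ratio `qa : ar = t / (1 - t)`.
  have hu : UnitPos R (t / (1 - t)) := ht.div ht'
  refine ⟨along s q (1 + t / (1 - t)), hs.along hq (R.add_mem R.one_mem hu.2.1), ?_,
    betw_along_one hsq hu⟩
  convert betw_along_one hpa hu using 1
  have hne := ht'.1.ne'
  rw [e₂, e₁]
  refine Prod.ext ?_ ?_ <;> simp only [along] <;> field_simp <;> ring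

/-! ### The lower dimension law -/

theorem exists_equilateral (hF : ∀ x : F, 0 ≤ x → ∃ z : F, z * z = x) (hR : IsConvexSubring R) :
    ∃ α β γ c₁ c₂ c₃ c₄ : F × F, (CoordMem R α ∧ CoordMem R β ∧ CoordMem R γ ∧ CoordMem R c₁ ∧
      CoordMem R c₂ ∧ CoordMem R c₃ ∧ CoordMem R c₄) ∧
      distSq α β = distSq β γ ∧ distSq α β = distSq α γ ∧ α ≠ β ∧
      (Betw R α c₁ β ∧ distSq α c₁ = distSq c₁ β) ∧
      (Betw R α c₂ γ ∧ distSq α c₂ = distSq c₂ γ) ∧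
      (Betw R β c₃ γ ∧ distSq β c₃ = distSq c₃ γ) ∧
      (Betw R β c₄ c₂ ∧ Betw R γ c₄ c₁) := by
  obtain ⟨z, hz⟩ := hF 3 (by norm_num)
  have hnat : ∀ n : ℕ, (n : F) ∈ R := natCast_mem R
  have hzR : z ∈ R := hR.mem_of_mul_self_mem (hz ▸ by exact_mod_cast hnat 3)
  have hu : ∀ n : ℕ, 1 ≤ n → UnitPos R (n : F) := fun n hn => UnitPos.natCast hR hn
  have h6 : (6 : F) ∈ R := by exact_mod_cast hnat 6
  have h3 : (3 : F) ∈ R := by exact_mod_cast hnat 3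
  have h2 : (2 : F) ∈ R := by exact_mod_cast hnat 2
  have h9 : (9 : F) ∈ R := by exact_mod_cast hnat 9
  have h12 : (12 : F) ∈ R := by exact_mod_cast hnat 12
  -- An equilateral triangle with `z² = 3`, its midpoints and its centroid. Side `12` avoids
  -- fractions, and the dot products to be tested become the natural numbers `36` and `24`.
  refine ⟨(0, 0), (12, 0), (6, 6 * z), (6, 0), (3, 3 * z), (9, 3 * z), (6, 2 * z),
    ⟨⟨R.zero_mem, R.zero_mem⟩, ⟨h12, R.zero_mem⟩, ⟨h6, R.mul_mem h6 hzR⟩, ⟨h6, R.zero_mem⟩,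
      ⟨h3, R.mul_mem h3 hzR⟩, ⟨h9, R.mul_mem h3 hzR⟩, ⟨h6, R.mul_mem h2 hzR⟩⟩, ?_⟩
  simp only [distSq, Betw, dot, cross, Prod.fst_sub, Prod.snd_sub]
  refine ⟨?_, ?_, ?_, ⟨⟨?_, ?_⟩, ?_⟩, ⟨⟨?_, ?_⟩, ?_⟩, ⟨⟨?_, ?_⟩, ?_⟩, ⟨?_, ?_⟩, ⟨?_, ?_⟩⟩
  · linear_combination -36 * hz
  · linear_combination -36 * hz
  · simp
  · ring
  · convert hu 36 (by norm_num) using 1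
    norm_num
  · ring
  · ring
  · convert hu 36 (by norm_num) using 1
    push_cast
    linear_combination 9 * hz
  · ring
  · ring
  · convert hu 36 (by norm_num) using 1
    push_cast
    linear_combination 9 * hz
  · ring
  · ring
  · convert hu 24 (by norm_num) using 1
    push_cast
    linear_combination 2 * hz
  · ring
  · convert hu 24 (by norm_num) using 1
    push_cast
    linear_combination 8 * hz

end Plane

/-! ### The nodes as convex subrings of `F` -/

section Node

variable (F : Type u) [Field F] [LinearOrder F] [IsStrictOrderedRing F]

/-- The convex subring of `F` at a node. -/
def nodeRing : Bool → Subring F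
  | false => finiteSubring F
  | true => ⊤

/-- The inclusion of a node in `F`. -/
def nodeVal : (w : Bool) → Node F w →+* F
  | false => (finiteSubring F).subtype
  | true => RingHom.id F

variable {F}

theorem isConvexSubring_nodeRing (w : Bool) : IsConvexSubring (nodeRing F w) := by
  cases w
  exacts [isConvexSubring_finiteSubring, isConvexSubring_top]

theorem nodeVal_mem (w : Bool) (x : Node F w) : nodeVal F w x ∈ nodeRing F w := by
  cases w
  exacts [x.2, trivial]

theorem nodeVal_injective (w : Bool) : Function.Injective (nodeVal F w) := by
  cases w
  exacts [Subtype.val_injective, Function.injective_id]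

theorem exists_nodeVal_eq {w : Bool} {x : F} (hx : x ∈ nodeRing F w) : ∃ y, nodeVal F w y = x := by
  cases w
  exacts [⟨⟨x, hx⟩, rfl⟩, ⟨x, rfl⟩]

theorem nodeVal_map {w v : Bool} (h : w ≤ v) (x : Node F w) :
    nodeVal F v (nodeMap F h x) = nodeVal F w x := by
  cases w <;> cases v <;> first | rfl | exact absurd h (by decide)

/-- For an element of `F₀`, not being infinitesimal means being nonzero with inverse in `F₀`. This
reduces both nodes to `UnitPos`. -/
theorem nodePos_iff (w : Bool) (x : Node F w) :
    nodePos F w x ↔ UnitPos (nodeRing F w) (nodeVal F w x) := by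
  cases w
  · show (0 < (x : finiteSubring F).1 ∧ ¬ (x.1 = 0 ∨ x.1⁻¹ ∉ finiteSubring F)) ↔
      UnitPos (finiteSubring F) x.1
    constructor
    · rintro ⟨h₁, h₂⟩
      exact ⟨h₁, x.2, by_contra fun h => h₂ (.inr h)⟩
    · rintro ⟨h₁, -, h₂⟩
      exact ⟨h₁, by rintro (h | h); exacts [h₁.ne' h, h h₂]⟩
  · exact unitPos_top.symm

end Node

/-! ### The field model -/

section FieldModel

variable {F : Type u} [Field F] [LinearOrder F] [IsStrictOrderedRing F]

/-- The value in `F` of an element of a node of the field model. -/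
def fieldVal {w : Bool} (x : (fieldModel F).carrier w) : F := nodeVal F w x

/-- The value in `F` of a term at a node of the field model. -/
def termVal {w : Bool} (ρ : ℕ → (fieldModel F).carrier w) (t : EFLang.Term ℕ) : F :=
  fieldVal (t.realize ρ)

section

variable {w : Bool} (ρ : ℕ → (fieldModel F).carrier w) (t s : EFLang.Term ℕ)

theorem termVal_zero : termVal ρ EF.zero = 0 := map_zero (nodeVal F w)

theorem termVal_one : termVal ρ EF.one = 1 := map_one (nodeVal F w)

theorem termVal_neg : termVal ρ (EF.neg t) = - termVal ρ t := map_neg (nodeVal F w) _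

theorem termVal_add : termVal ρ (EF.add t s) = termVal ρ t + termVal ρ s :=
  map_add (nodeVal F w) _ _

theorem termVal_mul : termVal ρ (EF.mul t s) = termVal ρ t * termVal ρ s :=
  map_mul (nodeVal F w) _ _

theorem termVal_mem : termVal ρ t ∈ nodeRing F w := nodeVal_mem w _

theorem termVal_map {v : Bool} (h : w ≤ v) :
    termVal (fun n => (fieldModel F).map h (ρ n)) t = termVal ρ t := by
  rw [termVal, KripkeModel.realize_map]
  exact nodeVal_map h _

theorem forces_eq : (fieldModel F).Forces (t ≐ s) w ρ ↔ termVal ρ t = termVal ρ s :=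
  (nodeVal_injective w).eq_iff.symm

theorem forces_pos : (fieldModel F).Forces (EF.P t) w ρ ↔ UnitPos (nodeRing F w) (termVal ρ t) :=
  nodePos_iff w _

theorem forces_not_pos : (fieldModel F).Forces (¬ᵢ EF.P t) w ρ ↔ ¬ 0 < termVal ρ t := by
  constructor
  · intro h h0
    refine h true (Bool.le_true w) ((forces_pos _ t).2 (unitPos_top.2 ?_))
    rwa [termVal_map]
  · intro h v hv h0
    have := ((forces_pos _ t).1 h0).1
    rw [termVal_map] at this
    exact h this

end

theorem exists_lt_of_not_archimedean (hA : ¬ Archimedean F) : ∃ x : F, ∀ n : ℕ, (n : F) < x := by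
  by_contra! h
  exact hA (archimedean_iff_nat_le.2 h)

/-- The reciprocal of an element exceeding every natural number. -/
theorem exists_infinitesimal (hA : ¬ Archimedean F) :
    ∃ x : F, 0 < x ∧ x ∈ finiteSubring F ∧ x⁻¹ ∉ finiteSubring F := by
  obtain ⟨x, hx⟩ := exists_lt_of_not_archimedean hA
  have h0 : 0 < x := by simpa using hx 0
  refine ⟨x⁻¹, inv_pos.2 h0, ⟨1, ?_⟩, ?_⟩
  · rw [abs_of_pos (inv_pos.2 h0)]
    exact (inv_le_one_of_one_le₀ (by simpa using (hx 1).le)).trans (by simp)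
  · rintro ⟨n, hn⟩
    rw [inv_inv, abs_of_pos h0] at hn
    exact absurd (hx n) hn.not_gt

theorem fieldModel_not_markov (hA : ¬ Archimedean F) :
    ¬ (fieldModel F).Satisfies false EF.markov := by
  obtain ⟨x, hx, hxR, hx'⟩ := exists_infinitesimal hA
  intro h
  let y : Node F false := (⟨x, hxR⟩ : finiteSubring F)
  have := h (fun _ => y) false le_rfl y false le_rfl ?_
  · exact hx' ((forces_pos _ (EF.v 0)).1 this).2.2
  · intro v hv hn
    have := (forces_not_pos _ (EF.v 0)).1 hn
    rw [termVal_map] at this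
    exact this hx

theorem fieldModel_isModelOf (hF : ∀ x : F, 0 ≤ x → ∃ z : F, z * z = x) :
    (fieldModel F).IsModelOf EF.theory := by
  have hR := isConvexSubring_nodeRing (F := F)
  intro φ hφ
  rcases hφ with hφ | hφ
  · rcases hφ with rfl | rfl | rfl | rfl | rfl | rfl | rfl | rfl <;>
      refine (fieldModel F).satisfies_alls _ fun w ρ => (forces_eq _ _ _).2 ?_ <;>
      simp only [termVal_add, termVal_mul, termVal_neg, termVal_zero, termVal_one] <;> ring
  rcases hφ with rfl | rfl | rfl | rfl | rfl | rfl | rfl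
  · refine (fieldModel F).satisfies_alls_imp _ fun w ρ h => ?_
    by_contra hne
    -- Equality is stable because passing to a later node does not change values in `F`.
    refine h w le_rfl fun v hv he => hne ?_
    rw [forces_eq, termVal_map, termVal_map, termVal_map, termVal_map] at he
    exact (forces_eq _ _ _).2 he
  · intro w ρ v hv h
    rw [forces_eq, termVal_zero, termVal_one] at h
    exact zero_ne_one h
  · refine (fieldModel F).satisfies_alls_imp _ fun w ρ h => ?_
    rw [forces_pos] at h
    obtain ⟨y, hy⟩ := exists_nodeVal_eq h.2.2
    have hy' : termVal (KripkeModel.extend y ρ) (EF.v 0) = _ := hy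
    refine ⟨y, (forces_eq _ _ _).2 ?_, (forces_pos _ _).2 (hy' ▸ h.inv)⟩
    rw [termVal_mul, termVal_one]
    exact (congrArg (termVal ρ (EF.v 0) * ·) hy).trans (mul_inv_cancel₀ h.1.ne')
  · refine (fieldModel F).satisfies_alls_imp _ fun w ρ ⟨h₁, h₂⟩ => ?_
    rw [forces_pos] at h₁ h₂
    refine ⟨(forces_pos _ _).2 ?_, (forces_pos _ _).2 ?_⟩
    · rw [termVal_add]
      exact h₁.add (hR w) h₂
    · rw [termVal_mul]
      exact h₁.mul h₂
  · refine (fieldModel F).satisfies_alls_imp _ fun w ρ h v hv ⟨h₁, h₂⟩ => ?_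
    rw [forces_eq, termVal_add, termVal_zero] at h
    rw [forces_pos, termVal_map] at h₁ h₂
    linarith [h₁.1, h₂.1]
  · refine (fieldModel F).satisfies_alls_imp _ fun w ρ ⟨h, h₁, h₂⟩ => ?_
    rw [forces_eq, termVal_add, termVal_zero] at h
    rw [forces_not_pos] at h₁ h₂
    rw [forces_eq, termVal_zero]
    linarith
  · refine (fieldModel F).satisfies_alls_imp _ fun w ρ ⟨h, h₁⟩ => ?_
    rw [forces_eq, termVal_add, termVal_zero] at h
    rw [forces_not_pos] at h₁
    obtain ⟨z, hz⟩ := hF (termVal ρ (EF.v 0)) (by linarith)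
    obtain ⟨y, rfl⟩ := exists_nodeVal_eq (w := w)
      ((hR w).mem_of_mul_self_mem (hz ▸ termVal_mem ρ (EF.v 0)))
    refine ⟨y, (forces_eq _ _ _).2 ?_⟩
    rw [termVal_mul]
    exact hz

end FieldModel

/-! ### A non-Archimedean Euclidean field -/

/-- Square roots are taken termwise; the representing sequence is nonnegative at almost every index.
-/
theorem Hyperreal.exists_mul_self_eq (x : Hyperreal) (hx : 0 ≤ x) : ∃ z : Hyperreal, z * z = x := by
  obtain ⟨f, rfl⟩ := Hyperreal.ofSeq_surjective x
  have h : ∀ᶠ n in (Filter.hyperfilter ℕ : Filter ℕ), 0 ≤ f n := Filter.Germ.coe_le.1 hx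
  refine ⟨Hyperreal.ofSeq fun n => √(f n), Filter.Germ.coe_eq.2 ?_⟩
  filter_upwards [h] with n hn
  exact Real.mul_self_sqrt hn

theorem Hyperreal.not_archimedean : ¬ Archimedean Hyperreal := by
  intro h
  obtain ⟨n, hn⟩ := exists_nat_gt Hyperreal.omega
  have := Hyperreal.coe_lt_omega (n : ℝ)
  exact lt_asymm hn this

/-! ### Negation over two nodes -/

namespace KripkeModel

variable {L : FirstOrder.Language.{0, 0}} (M : KripkeModel.{u} L Bool)

/-- Every node lies below `true`, so by persistence a formula forced anywhere above `w` is forced at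
the top. -/
theorem forces_neg_iff (φ : Fml L) {w : Bool} (ρ : ℕ → M.carrier w) :
    M.Forces (¬ᵢ φ) w ρ ↔ ¬ M.Forces φ true fun n => M.map (Bool.le_true w) (ρ n) := by
  refine ⟨fun h => h true (Bool.le_true w), fun h v hv hφ => h ?_⟩
  have := M.forces_mono φ (Bool.le_true v) _ hφ
  simpa only [← M.map_trans hv (Bool.le_true v)] using this

theorem forces_neg_neg_iff (φ : Fml L) {w : Bool} (ρ : ℕ → M.carrier w) :
    M.Forces (¬ᵢ ¬ᵢ φ) w ρ ↔ M.Forces φ true fun n => M.map (Bool.le_true w) (ρ n) := by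
  rw [forces_neg_iff, forces_neg_iff, map_refl_comp, not_not]

end KripkeModel

/-! ### The plane model -/

section PlaneModel

variable {F : Type u} [Field F] [LinearOrder F] [IsStrictOrderedRing F]

/-- The point of `F × F` given by an element of a node of the plane model. -/
def ptVal {w : Bool} (x : (planeModel F).carrier w) : F × F :=
  Prod.map (nodeVal F w) (nodeVal F w) x

variable {w : Bool} {ρ : ℕ → (planeModel F).carrier w}

theorem ptVal_mem (x : (planeModel F).carrier w) : CoordMem (nodeRing F w) (ptVal x) :=
  ⟨nodeVal_mem w _, nodeVal_mem w _⟩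

theorem exists_ptVal_eq {p : F × F} (hp : CoordMem (nodeRing F w) p) :
    ∃ x : (planeModel F).carrier w, ptVal x = p := by
  obtain ⟨x, hx⟩ := exists_nodeVal_eq hp.1
  obtain ⟨y, hy⟩ := exists_nodeVal_eq hp.2
  exact ⟨(x, y), Prod.ext hx hy⟩

theorem ptVal_injective : Function.Injective (ptVal (F := F) (w := w)) :=
  (nodeVal_injective w).prodMap (nodeVal_injective w)

theorem ptVal_map {v : Bool} (h : w ≤ v) (x : (planeModel F).carrier w) :
    ptVal ((planeModel F).map h x) = ptVal x :=
  Prod.ext (nodeVal_map h _) (nodeVal_map h _)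

theorem map_dot_sub {A B : Type u} [CommRing A] [CommRing B] (f : A →+* B) (a b c d : A × A) :
    f (dot (a - b) (c - d)) = dot (Prod.map f f a - Prod.map f f b)
      (Prod.map f f c - Prod.map f f d) := by
  simp [dot]

theorem map_cross_sub {A B : Type u} [CommRing A] [CommRing B] (f : A →+* B) (a b c d : A × A) :
    f (cross (a - b) (c - d)) = cross (Prod.map f f a - Prod.map f f b)
      (Prod.map f f c - Prod.map f f d) := by
  simp [cross]

theorem forces_B (a b c : ℕ) : (planeModel F).Forces (EG.B a b c) w ρ ↔
    Betw (nodeRing F w) (ptVal (ρ a)) (ptVal (ρ b)) (ptVal (ρ c)) := by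
  have key : ∀ a b c : Node F w × Node F w,
      (cross (c - b) (b - a) = 0 ∧ nodePos F w (dot (b - c) (a - b))) ↔
        Betw (nodeRing F w) (Prod.map (nodeVal F w) (nodeVal F w) a)
          (Prod.map (nodeVal F w) (nodeVal F w) b) (Prod.map (nodeVal F w) (nodeVal F w) c) := by
    intro a b c
    rw [nodePos_iff, map_dot_sub, Betw, ← map_cross_sub, map_eq_zero_iff _ (nodeVal_injective w)]
  exact key _ _ _

theorem forces_E (a b c d : ℕ) : (planeModel F).Forces (EG.E a b c d) w ρ ↔
    distSq (ptVal (ρ a)) (ptVal (ρ b)) = distSq (ptVal (ρ c)) (ptVal (ρ d)) := by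
  have key : ∀ a b c d : Node F w × Node F w,
      dot (b - a) (b - a) = dot (d - c) (d - c) ↔
        distSq (Prod.map (nodeVal F w) (nodeVal F w) a) (Prod.map (nodeVal F w) (nodeVal F w) b) =
        distSq (Prod.map (nodeVal F w) (nodeVal F w) c)
          (Prod.map (nodeVal F w) (nodeVal F w) d) := by
    intro a b c d
    rw [distSq, distSq, ← map_dot_sub, ← map_dot_sub, (nodeVal_injective w).eq_iff]
  exact key _ _ _ _

theorem forces_same (a b : ℕ) : (planeModel F).Forces (EG.same a b) w ρ ↔
    ptVal (ρ a) = ptVal (ρ b) :=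
  ptVal_injective.eq_iff.symm

theorem forces_T (a b c : ℕ) : (planeModel F).Forces (EG.T a b c) w ρ ↔
    WeakBetw (ptVal (ρ a)) (ptVal (ρ b)) (ptVal (ρ c)) := by
  rw [EG.T, KripkeModel.forces_neg_iff]
  simp only [KripkeModel.Forces, KripkeModel.forces_neg_iff, forces_same, forces_B, ptVal_map]
  rw [WeakBetw]
  show ¬ (¬ _ ∧ ¬ Betw ⊤ _ _ _ ∧ ¬ _) ↔ _
  tauto

theorem forces_L (a b c : ℕ) : (planeModel F).Forces (EG.L a b c) w ρ ↔
    Betw ⊤ (ptVal (ρ c)) (ptVal (ρ a)) (ptVal (ρ b)) ∨ ptVal (ρ c) = ptVal (ρ a) ∨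
      Betw ⊤ (ptVal (ρ a)) (ptVal (ρ c)) (ptVal (ρ b)) ∨ ptVal (ρ c) = ptVal (ρ b) ∨
      Betw ⊤ (ptVal (ρ a)) (ptVal (ρ b)) (ptVal (ρ c)) := by
  rw [EG.L, KripkeModel.forces_neg_neg_iff]
  simp only [KripkeModel.Forces, forces_same, forces_B, ptVal_map]
  rfl

theorem forces_not_B (a b c : ℕ) : (planeModel F).Forces (¬ᵢ EG.B a b c) w ρ ↔
    ¬ Betw ⊤ (ptVal (ρ a)) (ptVal (ρ b)) (ptVal (ρ c)) := by
  rw [KripkeModel.forces_neg_iff, forces_B]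
  simp only [ptVal_map]
  rfl

theorem forces_distinct (a b : ℕ) : (planeModel F).Forces (EG.distinct a b) w ρ ↔
    UnitPos (nodeRing F w) (distSq (ptVal (ρ a)) (ptVal (ρ b))) := by
  rw [← exists_betw_iff (isConvexSubring_nodeRing w) (ptVal_mem _) (ptVal_mem _)]
  constructor
  · rintro ⟨c, h⟩
    exact ⟨ptVal c, ptVal_mem c,
      h.imp (forces_B _ _ _).1 (Or.imp (forces_B _ _ _).1 (forces_B _ _ _).1)⟩
  · rintro ⟨c, hc, h⟩
    obtain ⟨c, rfl⟩ := exists_ptVal_eq hc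
    exact ⟨c, h.imp (forces_B _ _ _).2 (Or.imp (forces_B _ _ _).2 (forces_B _ _ _).2)⟩

theorem forces_ray {a b x : ℕ} (h : (planeModel F).Forces (EG.Ray a b x) w ρ) :
    ∃ t, UnitPos (nodeRing F w) t ∧ ptVal (ρ x) = along (ptVal (ρ a)) (ptVal (ρ b)) t := by
  obtain ⟨d, h₁, h₂⟩ := h
  exact exists_along_of_betw_betw (ptVal_mem d) (ptVal_mem _) (ptVal_mem _) (ptVal_mem _)
    ((forces_B _ _ _).1 h₁) ((forces_B _ _ _).1 h₂)

theorem forces_rightAngle {a b c : ℕ} (h : (planeModel F).Forces (EG.R a b c) w ρ) :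
    UnitPos (nodeRing F w)
      (cross (ptVal (ρ a) - ptVal (ρ b)) (ptVal (ρ c) - ptVal (ρ b)) ^ 2) := by
  obtain ⟨d, h₁, h₂, h₃, -, h₄, -⟩ := h
  exact cross_of_right_angle (ptVal_mem _) (ptVal_mem _) (ptVal_mem d) ((forces_B _ _ _).1 h₁)
    ((forces_E _ _ _ _).1 h₂) ((forces_E _ _ _ _).1 h₃) ((forces_distinct _ _).1 h₄)

theorem forces_angleCong {a b c a' b' c' : ℕ}
    (h : (planeModel F).Forces (EG.angleCong a b c a' b' c') w ρ)
    (h' : UnitPos (nodeRing F w)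
      (cross (ptVal (ρ a') - ptVal (ρ b')) (ptVal (ρ c') - ptVal (ρ b')) ^ 2)) :
    UnitPos (nodeRing F w)
      (cross (ptVal (ρ a) - ptVal (ρ b)) (ptVal (ρ c) - ptVal (ρ b)) ^ 2) := by
  obtain ⟨u, v, u', v', hu, hv, hu', hv', h₁, h₂, h₃⟩ := h
  obtain ⟨s, hs, e₁⟩ := forces_ray hu
  obtain ⟨t, ht, e₂⟩ := forces_ray hv
  obtain ⟨s', hs', e₃⟩ := forces_ray hu'
  obtain ⟨t', ht', e₄⟩ := forces_ray hv'
  rw [forces_E, e₁, e₃] at h₁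
  rw [forces_E, e₂, e₄] at h₂
  rw [forces_E, e₁, e₂, e₃, e₄] at h₃
  exact UnitPos.cross_of_angle_congruent (ptVal_mem _) (ptVal_mem _) (ptVal_mem _) hs ht hs' ht'
    h₁ h₂ h₃ h'

theorem forces_posAngle {a b c : ℕ} (h : (planeModel F).Forces (EG.posAngle a b c) w ρ) :
    DirApart (nodeRing F w) (ptVal (ρ a)) (ptVal (ρ b)) (ptVal (ρ c)) := by
  have hR := isConvexSubring_nodeRing (F := F) w
  rcases h with ⟨u, v, hu, hv, h₁, h₂⟩ | h | ⟨a', b', c', h₁, h₂⟩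
  · obtain ⟨s, hs, e₁⟩ := forces_ray hu
    obtain ⟨t, ht, e₂⟩ := forces_ray hv
    rw [forces_E, e₁, e₂] at h₁
    rw [forces_distinct, e₁, e₂] at h₂
    exact dirApart_of_isosceles hR (ptVal_mem _) (ptVal_mem _) (ptVal_mem _) hs ht h₁ h₂
  · exact dirApart_of_cross hR (ptVal_mem _) (ptVal_mem _) (ptVal_mem _) (forces_rightAngle h)
  · refine dirApart_of_cross hR (ptVal_mem _) (ptVal_mem _) (ptVal_mem _)
      (forces_angleCong (a := a + 3) (b := b + 3) (c := c + 3) h₁ ?_)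
    -- The right angle is at `a'` or at `c'`. The cross product is twice the signed area, so its
    -- square is the same at all three vertices.
    rcases h₂ with h₂ | h₂
    · convert forces_rightAngle h₂ using 1
      simp only [cross, Prod.fst_sub, Prod.snd_sub]
      ring
    · convert forces_rightAngle h₂ using 1
      simp only [cross, Prod.fst_sub, Prod.snd_sub]
      ring

theorem forces_properAngle (hF : ∀ x : F, 0 ≤ x → ∃ z : F, z * z = x) {a b c : ℕ}
    (h : (planeModel F).Forces (EG.properAngle a b c) w ρ) :
    UnitPos (nodeRing F w)
      (cross (ptVal (ρ a) - ptVal (ρ b)) (ptVal (ρ c) - ptVal (ρ b)) ^ 2) := by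
  obtain ⟨h₁, d, h₂, h₃⟩ := h
  exact cross_of_dirApart hF (ptVal_mem _) (ptVal_mem _) (ptVal_mem d) (forces_posAngle h₁)
    ((forces_B _ _ _).1 h₂) (forces_posAngle h₃)

theorem planeModel_not_markov (hA : ¬ Archimedean F) :
    ¬ (planeModel F).Satisfies false EG.markov := by
  obtain ⟨x, hx, hxR, hx'⟩ := exists_infinitesimal hA
  have h0 := (finiteSubring F).zero_mem
  obtain ⟨a, ha⟩ := exists_ptVal_eq (w := false) (p := ((0, 0) : F × F)) ⟨h0, h0⟩
  obtain ⟨b, hb⟩ := exists_ptVal_eq (w := false) (p := ((1, 0) : F × F))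
    ⟨(finiteSubring F).one_mem, h0⟩
  obtain ⟨c, hc⟩ := exists_ptVal_eq (w := false) (p := ((1 + x, 0) : F × F))
    ⟨(finiteSubring F).add_mem (finiteSubring F).one_mem hxR, h0⟩
  intro h
  have hdot : dot (ptVal b - ptVal c) (ptVal a - ptVal b) = x := by
    rw [ha, hb, hc]
    simp [dot]
  -- The outermost quantifier binds the highest index, so the points are supplied in reverse order.
  have := h (fun _ => a) false le_rfl c false le_rfl b false le_rfl a false le_rfl ?_
  · have := ((forces_B _ _ _).1 this).2
    have : UnitPos (nodeRing F false) (dot (ptVal b - ptVal c) (ptVal a - ptVal b)) := by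
      simpa only [KripkeModel.extend, ptVal_map] using this
    rw [hdot] at this
    exact hx' this.2.2
  · rw [KripkeModel.forces_neg_neg_iff, forces_B]
    simp only [KripkeModel.extend, ptVal_map]
    refine betw_top_iff.2 ⟨?_, hdot ▸ hx⟩
    rw [ha, hb, hc]
    simp [cross]

end PlaneModel

/-! ### Verification of the axioms of EG -/

section PlaneModel

variable {F : Type u} [Field F] [LinearOrder F] [IsStrictOrderedRing F]

theorem forces_L_along {w : Bool} {ρ : ℕ → (planeModel F).carrier w} {a b x : ℕ} {t : F}
    (hab : ptVal (ρ a) ≠ ptVal (ρ b)) (h : ptVal (ρ x) = along (ptVal (ρ a)) (ptVal (ρ b)) t) :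
    (planeModel F).Forces (EG.L a b x) w ρ := by
  rw [forces_L, h]
  exact collinear_along hab t

/-- A common proof of both forms of line-circle continuity. -/
theorem planeModel_line_circle (hF : ∀ x : F, 0 ≤ x → ∃ z : F, z * z = x) {w : Bool}
    {a b c u v p q : (planeModel F).carrier w}
    (hab : UnitPos (nodeRing F w) (distSq (ptVal a) (ptVal b)))
    (h₁ : WeakBetw (ptVal u) (ptVal a) (ptVal v))
    (h₂ : distSq (ptVal c) (ptVal u) = distSq (ptVal p) (ptVal q))
    (h₃ : distSq (ptVal c) (ptVal v) = distSq (ptVal p) (ptVal q))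
    (h₄ : WeakBetw (ptVal u) (ptVal c) (ptVal v)) :
    ∃ (s t : F) (x y : (planeModel F).carrier w), ptVal x = along (ptVal a) (ptVal b) s ∧
      ptVal y = along (ptVal a) (ptVal b) t ∧
      distSq (ptVal c) (ptVal x) = distSq (ptVal p) (ptVal q) ∧
      distSq (ptVal c) (ptVal y) = distSq (ptVal p) (ptVal q) ∧
      cross (ptVal y - ptVal a) (ptVal a - ptVal x) = 0 ∧
      dot (ptVal a - ptVal y) (ptVal x - ptVal a) =
        dot (ptVal a - ptVal v) (ptVal u - ptVal a) := by
  have heq := h₂.trans h₃.symm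
  obtain ⟨s, t, hs, ht, e₁, e₂, e₃, e₄⟩ := exists_line_circle hF (isConvexSubring_nodeRing w)
    (ptVal_mem a) (ptVal_mem b) (ptVal_mem c) ((ptVal_mem c).distSq (ptVal_mem u)) hab
    (distSq_le_of_diameter h₁ h₄ heq)
  -- The power of `a` is the same along the chord and along the diameter `u v`, so betweenness of
  -- `a`, strict or not, passes from `u`, `v` to `x`, `y`.
  rw [← dot_eq_of_diameter h₄ heq] at e₄
  obtain ⟨x, hx⟩ := exists_ptVal_eq hs
  obtain ⟨y, hy⟩ := exists_ptVal_eq ht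
  rw [← hx] at e₁ e₃ e₄
  rw [← hy] at e₂ e₃ e₄
  exact ⟨s, t, x, y, hx, hy, e₁.trans h₂, e₂.trans h₂, e₃, e₄⟩

theorem planeModel_lineCircle (hF : ∀ x : F, 0 ≤ x → ∃ z : F, z * z = x) :
    ∀ w, (planeModel F).Satisfies w EG.lineCircle := by
  refine (planeModel F).satisfies_alls_imp _ fun w ρ ⟨hab, h₁, h₂, h₃, h₄⟩ => ?_
  rw [forces_distinct] at hab
  rw [forces_B] at h₁ h₄
  rw [forces_E] at h₂ h₃
  obtain ⟨s, t, x, y, hx, hy, e₁, e₂, e₃, e₄⟩ :=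
    planeModel_line_circle hF hab (.inr (.inl h₁.top)) h₂ h₃ (.inr (.inl h₄.top))
  have hne := ne_of_unitPos_distSq hab
  exact ⟨x, y, (forces_E _ _ _ _).2 e₁, (forces_E _ _ _ _).2 e₂,
    (forces_B _ _ _).2 ⟨e₃, e₄.symm ▸ h₁.2⟩, forces_L_along hne hx, forces_L_along hne hy⟩

theorem planeModel_lineCircleNonstrict (hF : ∀ x : F, 0 ≤ x → ∃ z : F, z * z = x) :
    ∀ w, (planeModel F).Satisfies w EG.lineCircleNonstrict := by
  refine (planeModel F).satisfies_alls_imp _ fun w ρ ⟨hab, h₁, h₂, h₃, h₄⟩ => ?_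
  rw [forces_distinct] at hab
  rw [forces_T] at h₁ h₄
  rw [forces_E] at h₂ h₃
  obtain ⟨s, t, x, y, hx, hy, e₁, e₂, e₃, e₄⟩ := planeModel_line_circle hF hab h₁ h₂ h₃ h₄
  have hne := ne_of_unitPos_distSq hab
  exact ⟨x, y, (forces_E _ _ _ _).2 e₁, (forces_E _ _ _ _).2 e₂,
    (forces_T _ _ _).2 (weakBetw_iff.2 ⟨e₃, e₄.symm ▸ (weakBetw_iff.1 h₁).2⟩),
    forces_L_along hne hx, forces_L_along hne hy⟩

theorem WeakBetw.distSq_le {a b c : F × F} (h : WeakBetw a b c) : distSq a b ≤ distSq a c := by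
  have h₂ := (weakBetw_iff.1 h).2
  have h₃ := distSq_nonneg b c
  have e : distSq a c = distSq a b + distSq b c + 2 * dot (b - c) (a - b) := by
    simp only [distSq, dot, Prod.fst_sub, Prod.snd_sub]
    ring
  linarith

/-- A common proof of both forms of circle-circle continuity. -/
theorem planeModel_circle_circle (hF : ∀ x : F, 0 ≤ x → ∃ z : F, z * z = x) {w : Bool}
    {a b c d u v z p q p' q' : (planeModel F).carrier w}
    (hcd : UnitPos (nodeRing F w) (distSq (ptVal c) (ptVal d)))
    (h₁ : distSq (ptVal c) (ptVal a) = distSq (ptVal p) (ptVal q))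
    (h₂ : WeakBetw (ptVal u) (ptVal a) (ptVal v)) (h₃ : WeakBetw (ptVal u) (ptVal d) (ptVal v))
    (h₄ : distSq (ptVal d) (ptVal u) = distSq (ptVal p') (ptVal q'))
    (h₅ : distSq (ptVal d) (ptVal v) = distSq (ptVal p') (ptVal q'))
    (h₆ : distSq (ptVal c) (ptVal b) = distSq (ptVal p) (ptVal q))
    (h₇ : WeakBetw (ptVal d) (ptVal z) (ptVal b))
    (h₈ : distSq (ptVal d) (ptVal z) = distSq (ptVal p') (ptVal q')) :
    ∃ e : (planeModel F).carrier w, distSq (ptVal c) (ptVal e) = distSq (ptVal p) (ptVal q) ∧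
      distSq (ptVal d) (ptVal e) = distSq (ptVal p') (ptVal q') := by
  have hin := distSq_le_of_diameter h₂ h₃ (h₄.trans h₅.symm)
  obtain ⟨e, he, e₁, e₂⟩ := circle_circle hF (isConvexSubring_nodeRing w) (ptVal_mem c)
    (ptVal_mem d) (ptVal_mem a) (ptVal_mem z) hcd (hin.trans_eq (h₄.trans h₈.symm))
    (h₆.trans h₁.symm) h₇.distSq_le
  obtain ⟨e, rfl⟩ := exists_ptVal_eq he
  exact ⟨e, e₁.trans h₁, e₂.trans h₈⟩

theorem planeModel_circleCircle (hF : ∀ x : F, 0 ≤ x → ∃ z : F, z * z = x) :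
    ∀ w, (planeModel F).Satisfies w EG.circleCircle := by
  refine (planeModel F).satisfies_alls_imp _ fun w ρ ⟨h₁, h₂, h₃, h₄, h₅, h₆, h₇, h₈⟩ => ?_
  rw [forces_E] at h₁ h₄ h₅ h₆ h₈
  rw [forces_T] at h₂ h₃
  rw [forces_B] at h₇
  have hin := distSq_le_of_diameter h₂ h₃ (h₄.trans h₅.symm)
  -- The axiom does not assume the centers apart; the point strictly outside forces it.
  have hcd := UnitPos.distSq_of_circles hF (isConvexSubring_nodeRing w) (ptVal_mem _) (ptVal_mem _)
    (ptVal_mem _) (ptVal_mem _) (hin.trans_eq (h₄.trans h₈.symm)) (h₆.trans h₁.symm) h₇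
  obtain ⟨e, e₁, e₂⟩ := planeModel_circle_circle hF hcd h₁ h₂ h₃ h₄ h₅ h₆ (.inr (.inl h₇.top)) h₈
  exact ⟨e, (forces_E _ _ _ _).2 e₁, (forces_E _ _ _ _).2 e₂⟩

theorem planeModel_circleCircleNonstrict (hF : ∀ x : F, 0 ≤ x → ∃ z : F, z * z = x) :
    ∀ w, (planeModel F).Satisfies w EG.circleCircleNonstrict := by
  refine (planeModel F).satisfies_alls_imp _ fun w ρ ⟨hcd, h₁, h₂, h₃, h₄, h₅, h₆, h₇, h₈⟩ => ?_
  rw [forces_distinct] at hcd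
  rw [forces_E] at h₁ h₄ h₅ h₆ h₈
  rw [forces_T] at h₂ h₃ h₇
  obtain ⟨e, e₁, e₂⟩ := planeModel_circle_circle hF hcd h₁ h₂ h₃ h₄ h₅ h₆ h₇ h₈
  exact ⟨e, (forces_E _ _ _ _).2 e₁, (forces_E _ _ _ _).2 e₂⟩

theorem planeModel_lowerDimension (hF : ∀ x : F, 0 ≤ x → ∃ z : F, z * z = x) (w : Bool) :
    (planeModel F).Satisfies w EG.lowerDimension := by
  intro ρ
  obtain ⟨α, β, γ, c₁, c₂, c₃, c₄, ⟨m₁, m₂, m₃, m₄, m₅, m₆, m₇⟩, h₁, h₂, h₃, ⟨h₄, h₅⟩, ⟨h₆, h₇⟩,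
    ⟨h₈, h₉⟩, h₁₀, h₁₁⟩ := exists_equilateral hF (isConvexSubring_nodeRing (F := F) w)
  obtain ⟨α, rfl⟩ := exists_ptVal_eq m₁
  obtain ⟨β, rfl⟩ := exists_ptVal_eq m₂
  obtain ⟨γ, rfl⟩ := exists_ptVal_eq m₃
  obtain ⟨c₁, rfl⟩ := exists_ptVal_eq m₄
  obtain ⟨c₂, rfl⟩ := exists_ptVal_eq m₅
  obtain ⟨c₃, rfl⟩ := exists_ptVal_eq m₆
  obtain ⟨c₄, rfl⟩ := exists_ptVal_eq m₇
  refine ⟨c₄, c₃, c₂, c₁, γ, β, α, (forces_E _ _ _ _).2 h₁, (forces_E _ _ _ _).2 h₂, ?_,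
    ⟨(forces_B _ _ _).2 h₄, (forces_E _ _ _ _).2 h₅⟩,
    ⟨(forces_B _ _ _).2 h₆, (forces_E _ _ _ _).2 h₇⟩,
    ⟨(forces_B _ _ _).2 h₈, (forces_E _ _ _ _).2 h₉⟩,
    (forces_B _ _ _).2 h₁₀, (forces_B _ _ _).2 h₁₁⟩
  rw [KripkeModel.forces_neg_iff, forces_same]
  simp only [ptVal_map]
  exact h₃

theorem planeModel_isModelOf (hF : ∀ x : F, 0 ≤ x → ∃ z : F, z * z = x) :
    (planeModel F).IsModelOf EG.theory := by
  have hR := isConvexSubring_nodeRing (F := F)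
  rintro φ (rfl | rfl | rfl | rfl | rfl | rfl | rfl | rfl | rfl | rfl | rfl | rfl | rfl | rfl |
    rfl | rfl | rfl | rfl | rfl)
  · exact (planeModel F).satisfies_alls _ fun w ρ => (forces_E _ _ _ _).2 (distSq_comm _ _)
  · refine (planeModel F).satisfies_alls_imp _ fun w ρ ⟨h₁, h₂⟩ => ?_
    rw [forces_E] at *
    exact h₁.symm.trans h₂
  · refine (planeModel F).satisfies_alls_imp _ fun w ρ h => ?_
    rw [forces_E, distSq_eq_zero.2 (Eq.refl (ptVal (ρ 2)))] at h
    exact (forces_same _ _).2 (distSq_eq_zero.1 h)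
  · refine (planeModel F).satisfies_alls_imp _ fun w ρ h => ?_
    rw [KripkeModel.forces_neg_neg_iff, forces_E] at h
    simp only [ptVal_map] at h
    exact (forces_E _ _ _ _).2 h
  · refine (planeModel F).satisfies_alls _ fun w ρ => ?_
    rw [forces_not_B]
    exact not_betw_self
  · refine (planeModel F).satisfies_alls_imp _ fun w ρ h => ?_
    rw [forces_B] at *
    exact h.symm
  · refine (planeModel F).satisfies_alls_imp _ fun w ρ ⟨h₁, h₂⟩ => ?_
    rw [forces_B] at *
    exact h₁.inner_trans (hR w) (ptVal_mem _) (ptVal_mem _) (ptVal_mem _) (ptVal_mem _) h₂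
  · refine (planeModel F).satisfies_alls_imp _ fun w ρ ⟨h₁, h₂, h₃, h₄⟩ => ?_
    rw [forces_B] at h₁ h₂
    rw [forces_not_B] at h₃ h₄
    exact (forces_same _ _).2 (h₁.top.connectivity h₂.top h₃ h₄)
  · refine (planeModel F).satisfies_alls_imp _ fun w ρ ⟨h₁, h₂⟩ => ?_
    rw [forces_distinct] at h₁
    rw [forces_E] at h₂
    obtain ⟨e, he, e₁, e₂⟩ := exists_weakBetw_distSq hF (hR w) (ptVal_mem (ρ 0)) (ptVal_mem (ρ 1))
      (ptVal_mem (ρ 2)) (ptVal_mem (ρ 3)) (h₂.symm ▸ h₁)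
    obtain ⟨e, rfl⟩ := exists_ptVal_eq he
    exact ⟨e, (forces_T _ _ _).2 e₁, (forces_E _ _ _ _).2 e₂⟩
  · refine (planeModel F).satisfies_alls_imp _ fun w ρ ⟨h₁, h₂, h₃, h₄⟩ => ?_
    rw [forces_distinct] at h₁ h₃
    rw [forces_E] at h₂ h₄
    obtain ⟨e, he, e₁, e₂⟩ := exists_betw_distSq hF (hR w) (ptVal_mem (ρ 0)) (ptVal_mem (ρ 1))
      (ptVal_mem (ρ 2)) (ptVal_mem (ρ 3)) (h₂.symm ▸ h₁) (h₄.symm ▸ h₃)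
    obtain ⟨e, rfl⟩ := exists_ptVal_eq he
    exact ⟨e, (forces_B _ _ _).2 e₁, (forces_E _ _ _ _).2 e₂⟩
  · refine (planeModel F).satisfies_alls_imp _ fun w ρ ⟨h₁, h₂, h₃, h₄, h₅, h₆, h₇⟩ => ?_
    rw [forces_distinct] at h₁
    rw [forces_T] at h₂ h₃
    rw [forces_E] at *
    exact five_segments (ne_of_unitPos_distSq h₁) h₂ h₃ h₄ h₅ h₆ h₇
  · refine (planeModel F).satisfies_alls_imp _ fun w ρ ⟨h₁, h₂, h₃⟩ => ?_
    rw [forces_B] at h₁ h₂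
    obtain ⟨x, hx, e₁, e₂⟩ := inner_pasch (hR w) (ptVal_mem _) (ptVal_mem _) (ptVal_mem _)
      (ptVal_mem _) (ptVal_mem _) h₁ h₂ (h₃.imp (forces_properAngle hF) (forces_properAngle hF))
    obtain ⟨x, rfl⟩ := exists_ptVal_eq hx
    exact ⟨x, (forces_B _ _ _).2 e₁, (forces_B _ _ _).2 e₂⟩
  · refine (planeModel F).satisfies_alls_imp _ fun w ρ ⟨h₁, h₂, h₃⟩ => ?_
    rw [forces_B] at h₁ h₂
    obtain ⟨x, hx, e₁, e₂⟩ := outer_pasch (hR w) (ptVal_mem _) (ptVal_mem _) (ptVal_mem _)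
      (ptVal_mem _) (ptVal_mem _) h₁ h₂ (h₃.imp (forces_properAngle hF) (forces_properAngle hF))
    obtain ⟨x, rfl⟩ := exists_ptVal_eq hx
    exact ⟨x, (forces_B _ _ _).2 e₁, (forces_B _ _ _).2 e₂⟩
  · exact planeModel_lowerDimension hF
  · exact planeModel_lineCircle hF
  · exact planeModel_lineCircleNonstrict hF
  · exact planeModel_circleCircle hF
  · exact planeModel_circleCircleNonstrict hF
  · refine (planeModel F).satisfies_alls_imp _ fun w ρ ⟨h₁, h₂, h₃, h₄, h₅, h₆, _, h₇⟩ => ?_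
    rw [forces_distinct] at h₁ h₂
    rw [forces_E] at h₃ h₅
    rw [forces_B] at h₄ h₆ h₇
    obtain ⟨e, he, e₁, e₂⟩ := euclid_five (hR w) (ptVal_mem _) (ptVal_mem _) (ptVal_mem _)
      (ptVal_mem _) h₁ h₂ h₃ (.inr (.inl h₄.top)) h₅ (.inr (.inl h₆.top)) h₇
    obtain ⟨e, rfl⟩ := exists_ptVal_eq he
    exact ⟨e, (forces_B _ _ _).2 e₁, (forces_B _ _ _).2 e₂⟩

end PlaneModel

theorem mainTheorem2 :
    -- Markov's principle is not derivable, in intuitionistic logic, from Euclidean field theory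
    -- or from geometry
    ¬ Provable EF.theory EF.markov ∧
    ¬ Provable EG.theory EG.markov ∧
    -- there is a non-Archimedean Euclidean field
    (∃ (F : Type) (_ : Field F) (_ : LinearOrder F) (_ : IsStrictOrderedRing F),
      (∀ x : F, 0 ≤ x → ∃ z : F, z * z = x) ∧ ¬ Archimedean F) ∧
    -- over each such field, the two-node models are as claimed; `false` is the root
    ∀ (F : Type u) [Field F] [LinearOrder F] [IsStrictOrderedRing F],
      (∀ x : F, 0 ≤ x → ∃ z : F, z * z = x) → ¬ Archimedean F →
        (fieldModel F).IsModelOf EF.theory ∧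
        ¬ (fieldModel F).Satisfies false EF.markov ∧
        (planeModel F).IsModelOf EG.theory ∧
        ¬ (planeModel F).Satisfies false EG.markov := by
  have hF := Hyperreal.exists_mul_self_eq
  have hA := Hyperreal.not_archimedean
  refine ⟨fun h => ?_, fun h => ?_, ⟨Hyperreal, _, _, inferInstance, hF, hA⟩, ?_⟩
  · exact fieldModel_not_markov hA ((fieldModel_isModelOf hF).satisfies_of_provable h false)
  · exact planeModel_not_markov hA ((planeModel_isModelOf hF).satisfies_of_provable h false)
  · intro F _ _ _ hF hA
    exact ⟨fieldModel_isModelOf hF, fieldModel_not_markov hA, planeModel_isModelOf hF,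
      planeModel_not_markov hA⟩
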